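/- Let $p \ge 1$ be real. A \emph{barycentric algebra} is a set $A$ with operations $+_r : A^2 \to A$ ($r \in [0,1]$) satisfying $x +_1 y = x$, $x +_r x = x$, $x +_r y = y +_{1-r} x$, and $(x +_s y) +_r z = x +_{sr} (y +_{(r-sr)/(1-sr)} z)$ whenever $r,s<1$; homomorphisms of barycentric algebras are called affine. An \emph{extended metric Wasserstein algebra of order $p$} is an extended metric space $(A,d)$ (distances in $[0,\infty]$) that is also a barycentric algebra whose operations $+_r : A^2\to A$ are nonexpansive for the maximum distance on $A^2$ and satisfy $$d(x +_r y,\, x' +_r y')^p \le r\, d(x,x')^p + (1-r)\, d(y,y')^p$$ for all $r\in[0,1]$ and $x,x',y,y' \in A$ (with $0\cdot\infty=0$). It is \emph{complete} if $(A,d)$ is. For a metric space $X$, let $P_p(X)$ be the set of Radon Borel probability measures $\mu$ on $X$ (every Borel set $B$ satisfies $\mu(B)=\sup\{\mu(C) : C\subseteq B \text{ compact}\}$) with $\int d(x_0,x)^p\,d\mu(x)<\infty$ for some $x_0\in X$, equipped with the Wasserstein distance $$W_p(\mu,\nu)=\Big(\inf_\gamma \int d(x,y)^p\,d\gamma(x,y)\Big)^{1/p},$$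 where $\gamma$ ranges over the Borel probability measures on $X\times X$ with marginals $\mu$ and $\nu$, and with the operations $\mu +_r \nu = r\mu+(1-r)\nu$. \textbf{Theorem.} For any complete metric space $X$, $P_p(X)$ is the free complete extended metric Wasserstein algebra of order $p$ over $X$, with universal arrow the Dirac delta function $\delta : X \to P_p(X)$. That is, $W_p$ is an extended metric on $P_p(X)$, with which $P_p(X)$ is a complete extended metric Wasserstein algebra of order $p$; $\delta$ is nonexpansive; and for every complete extended metric Wasserstein algebra $B$ of order $p$ and every nonexpansive map $f : X \to B$ there is a unique nonexpansive affine map $h : P_p(X) \to B$ with $h\circ\delta = f$. -/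

import Mathlib

open MeasureTheory Set
open scoped ENNReal unitInterval

universe u v

/-! ### Barycentric algebras and extended metric Wasserstein algebras -/

/-- `op r x y` is the barycentric operation `x +_r y`, for `r ∈ [0,1]`. -/
structure IsBarycentricAlgebra {A : Type*} (op : I → A → A → A) : Prop where
  one_left : ∀ x y, op 1 x y = x
  idem : ∀ r x, op r x x = x
  skew_comm : ∀ r x y, op r x y = op (unitInterval.symm r) y x
  /-- `(x +_s y) +_r z = x +_{sr} (y +_q z)` with `q = (r - sr) / (1 - sr)`, for `r, s < 1`. -/
  skew_assoc : ∀ s r q : I, r < 1 → s < 1 →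
    (q : ℝ) = ((r : ℝ) - (s : ℝ) * (r : ℝ)) / (1 - (s : ℝ) * (r : ℝ)) →
    ∀ x y z, op r (op s x y) z = op (s * r) x (op q y z)

/-- Wasserstein (barycentric) algebra of order `p` over an extended metric space.  The product
`A × A` carries the maximum distance. -/
structure IsWassersteinAlgebra (p : ℝ) {A : Type*} [EMetricSpace A] (op : I → A → A → A) : Prop
    extends IsBarycentricAlgebra op where
  nonexpansive : ∀ r, LipschitzWith 1 (fun z : A × A => op r z.1 z.2)
  edist_op_rpow_le : ∀ (r : I) (x x' y y' : A),
    edist (op r x y) (op r x' y') ^ p ≤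
      ENNReal.ofReal (r : ℝ) * edist x x' ^ p + ENNReal.ofReal (1 - (r : ℝ)) * edist y y' ^ p

/-- Homomorphisms of Wasserstein algebras: nonexpansive affine maps. -/
structure IsWassersteinHom {A B : Type*} [EMetricSpace A] [EMetricSpace B]
    (opA : I → A → A → A) (opB : I → B → B → B) (h : A → B) : Prop where
  nonexpansive : LipschitzWith 1 h
  map_op : ∀ r x y, h (opA r x y) = opB r (h x) (h y)

/-- The algebra `(A, op)` is the free complete extended metric Wasserstein algebra of order `p`
over `X`, with universal arrow `η : X → A`; the universal property is tested against all
complete extended metric Wasserstein algebras with carrier in the universe `c`. -/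
structure IsFreeCompleteWassersteinAlgebra.{a, b, c} (p : ℝ) {X : Type a} [EMetricSpace X]
    {A : Type b} [EMetricSpace A] (op : I → A → A → A) (η : X → A) : Prop where
  complete : CompleteSpace A
  isWassersteinAlgebra : IsWassersteinAlgebra p op
  nonexpansive : LipschitzWith 1 η
  existsUnique_extension : ∀ (B : Type c) [EMetricSpace B] [CompleteSpace B]
    (opB : I → B → B → B), IsWassersteinAlgebra p opB →
    ∀ f : X → B, LipschitzWith 1 f →
      ∃! h : A → B, IsWassersteinHom op opB h ∧ ∀ x, h (η x) = f x

/-! ### Wasserstein spaces -/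

/-- `γ` is a coupling of `μ` and `ν`.  It is a Borel probability measure on `X × X`; the Borel
σ-algebra of `X × X` can be strictly larger than the product σ-algebra when `X` is not
separable, so it is named explicitly. -/
structure IsCoupling {X : Type*} [TopologicalSpace X] [MeasurableSpace X] (μ ν : Measure X)
    (γ : @Measure (X × X) (borel (X × X))) : Prop where
  isProbabilityMeasure : @IsProbabilityMeasure (X × X) (borel (X × X)) γ
  map_fst : @Measure.map (X × X) X (borel (X × X)) _ Prod.fst γ = μ
  map_snd : @Measure.map (X × X) X (borel (X × X)) _ Prod.snd γ = ν

/-- The Wasserstein distance of order `p`. -/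
noncomputable def wassersteinDist (p : ℝ) {X : Type*} [MetricSpace X] [MeasurableSpace X]
    (μ ν : Measure X) : ℝ≥0∞ :=
  (⨅ (γ : @Measure (X × X) (borel (X × X))) (_ : IsCoupling μ ν γ),
    @lintegral (X × X) (borel (X × X)) γ (fun z => edist z.1 z.2 ^ p)) ^ (1 / p)

/-- Finite moment of order `p`. -/
def HasFiniteMoment (p : ℝ) {X : Type*} [MetricSpace X] [MeasurableSpace X]
    (μ : Measure X) : Prop :=
  ∃ x₀ : X, ∫⁻ x, edist x₀ x ^ p ∂μ < ∞

/-- The set `P_p(X)` of Radon probability measures on `X` with finite moment of order `p`.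
(`Measure.InnerRegular` says that every measurable set is compact inner regular.) -/
structure WassersteinSpace (p : ℝ) (X : Type*) [MetricSpace X] [MeasurableSpace X] where
  measure : Measure X
  isProbabilityMeasure : IsProbabilityMeasure measure
  isRadon : measure.InnerRegular
  hasFiniteMoment : HasFiniteMoment p measure

section

variable {X : Type*} [MetricSpace X] [MeasurableSpace X] {p : ℝ}

theorem HasFiniteMoment.basepoint (hp : 1 ≤ p) {μ : Measure X} [IsProbabilityMeasure μ]
    (h : HasFiniteMoment p μ) (x₁ : X) : ∫⁻ x, edist x₁ x ^ p ∂μ < ∞ := by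
  obtain ⟨x₀, h₀⟩ := h
  have hp0 : 0 ≤ p := by linarith
  refine lt_of_le_of_lt (lintegral_mono (g := fun x => (edist x₁ x₀ + edist x₀ x) ^ p)
    fun x => ENNReal.rpow_le_rpow (edist_triangle _ _ _) hp0) ?_
  refine ENNReal.lintegral_rpow_add_lt_top_of_lintegral_rpow_lt_top
    (f := fun _ => edist x₁ x₀) (g := fun x => edist x₀ x) aemeasurable_const ?_ h₀ hp
  simpa using ENNReal.rpow_lt_top_of_nonneg hp0 (edist_ne_top x₁ x₀)

variable [BorelSpace X]

/-- The Dirac delta `δ : X → P_p(X)`. -/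
noncomputable def WassersteinSpace.dirac (hp : 1 ≤ p) (x : X) : WassersteinSpace p X where
  measure := Measure.dirac x
  isProbabilityMeasure := inferInstance
  isRadon := by
    refine ⟨fun A hA r hr => ?_⟩
    by_cases hx : x ∈ A
    · refine ⟨{x}, by simpa using hx, isCompact_singleton, ?_⟩
      refine lt_of_lt_of_le hr ?_
      rw [Measure.dirac_apply_of_mem hx, Measure.dirac_apply_of_mem (mem_singleton x)]
    · rw [Measure.dirac_apply' x hA] at hr
      simp [hx] at hr
  hasFiniteMoment := ⟨x, by
    have hp0 : 0 < p := by linarith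
    simp [lintegral_dirac, ENNReal.zero_rpow_of_pos hp0]⟩

/-- The convex combination `(μ +_r ν)(B) = r μ(B) + (1 - r) ν(B)` on `P_p(X)`. -/
noncomputable def WassersteinSpace.convexComb (hp : 1 ≤ p) (r : I)
    (μ ν : WassersteinSpace p X) : WassersteinSpace p X where
  measure := ENNReal.ofReal (r : ℝ) • μ.measure + ENNReal.ofReal (1 - (r : ℝ)) • ν.measure
  isProbabilityMeasure := by
    have := μ.isProbabilityMeasure
    have := ν.isProbabilityMeasure
    refine ⟨?_⟩
    simp only [Measure.coe_add, Measure.coe_smul, Pi.add_apply, Pi.smul_apply, measure_univ,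
      smul_eq_mul, mul_one]
    rw [← ENNReal.ofReal_add r.2.1 (by linarith [r.2.2])]
    simp
  isRadon := by
    have := μ.isRadon
    have := ν.isRadon
    infer_instance
  hasFiniteMoment := by
    have := μ.isProbabilityMeasure
    have := ν.isProbabilityMeasure
    obtain ⟨x₀, h₀⟩ := μ.hasFiniteMoment
    have h₁ := ν.hasFiniteMoment.basepoint hp x₀
    refine ⟨x₀, ?_⟩
    rw [lintegral_add_measure, lintegral_smul_measure, lintegral_smul_measure]
    exact ENNReal.add_lt_top.2 ⟨ENNReal.mul_lt_top ENNReal.ofReal_lt_top h₀,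
      ENNReal.mul_lt_top ENNReal.ofReal_lt_top h₁⟩

end

/-! Finitely supported probability measures are the barycentric combinations of Dirac measures, and
they are dense in `P_p(X)`. A continuous affine map is therefore determined by its values on Dirac
measures. Conversely, `f` extends affinely to finitely supported measures, and it remains to bound
this extension by `W_p` (`edist_finsuppExtend_le`). A coupling of two finitely supported measures is
itself a finite sum of atoms `c_i δ_(x_i, y_i)`, and iterating the Wasserstein inequality gives `d(∑
c_i f(x_i), ∑ c_i f(y_i))^p ≤ ∑ c_i d(x_i, y_i)^p`. Completeness of `B` then yields the extension to
`P_p(X)`; affineness passes to the limit because the operations are continuous.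

Finite sums are awkward in an algebra that has only binary operations and skew associativity. They
are formed instead in the cone of weighted points, a commutative monoid whose slice of weight one is
the algebra. Formal combinations are then additive maps out of `X →₀ ℝ≥0`, and identities between
them are checked on single points.

For the metric, countably many Radon measures live on one closed separable set `Y`, which is Polish
because `X` is complete. On `Y × Y` the Borel and product σ-algebras agree, and couplings restrict
to it. Disintegration glues couplings of consecutive measures into a Markov chain
(`exists_measure_map_pair_eq`). Minkowski's inequality along this chain gives the triangle
inequality, and almost sure convergence of its paths gives completeness. -/

open scoped NNReal

/-! ### The cone over a barycentric algebra -/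

/-- The proportion `s / (s + t)` of two positive weights, as a point of the unit interval. -/
noncomputable def weightRatio (s t : ℝ) (hs : 0 < s) (ht : 0 < t) : I :=
  ⟨s / (s + t), by positivity, (div_le_one (by positivity)).2 (by linarith)⟩

/-- Points of positive weight of the cone over a barycentric algebra. -/
@[ext] structure PosCone {A : Type*} {op : I → A → A → A} (h : IsBarycentricAlgebra op) where
  weight : ℝ
  pos : 0 < weight
  point : A

namespace PosCone

variable {A : Type*} {op : I → A → A → A} {h : IsBarycentricAlgebra op}

noncomputable instance : Add (PosCone h) where
  add a b := ⟨a.weight + b.weight, add_pos a.pos b.pos,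
    op (weightRatio a.weight b.weight a.pos b.pos) a.point b.point⟩

theorem add_def (a b : PosCone h) : a + b = ⟨a.weight + b.weight, add_pos a.pos b.pos,
    op (weightRatio a.weight b.weight a.pos b.pos) a.point b.point⟩ := rfl

theorem weightRatio_lt_one {s t : ℝ} (hs : 0 < s) (ht : 0 < t) : weightRatio s t hs ht < 1 := by
  refine Subtype.coe_lt_coe.1 ?_
  change s / (s + t) < 1
  rw [div_lt_one (by positivity)]
  linarith

/-- The parameters in the skew laws are exactly the weight ratios that occur when three weighted
points are added in two orders, so skew associativity and skew commutativity become the ordinary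
laws. -/
noncomputable instance : AddCommSemigroup (PosCone h) where
  add_assoc a b c := by
    obtain ⟨s, hs, x⟩ := a
    obtain ⟨t, ht, y⟩ := b
    obtain ⟨w, hw, z⟩ := c
    simp only [add_def]
    have hst : 0 < s + t := by positivity
    have htw : 0 < t + w := by positivity
    rw [h.skew_assoc (weightRatio s t hs ht) (weightRatio (s + t) w hst hw)
      (weightRatio t w ht hw) (weightRatio_lt_one _ _) (weightRatio_lt_one _ _)]
    · have : weightRatio s t hs ht * weightRatio (s + t) w hst hw
          = weightRatio s (t + w) hs htw := by
        refine Subtype.ext ?_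
        change s / (s + t) * ((s + t) / (s + t + w)) = s / (s + (t + w))
        field_simp
        ring
      simp only [this]
      ext
      · exact add_assoc s t w
      · rfl
    · change t / (t + w) = ((s + t) / (s + t + w) - s / (s + t) * ((s + t) / (s + t + w))) /
        (1 - s / (s + t) * ((s + t) / (s + t + w)))
      have h1 : s / (s + t) * ((s + t) / (s + t + w)) = s / (s + t + w) := by field_simp
      rw [h1, ← sub_div, one_sub_div (by positivity)]
      have h2 : s + t + w - s = t + w := by ring
      have h3 : s + t - s = t := by ring
      rw [h2, h3]
      field_simp
  add_comm a b := by
    obtain ⟨s, hs, x⟩ := a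
    obtain ⟨t, ht, y⟩ := b
    simp only [add_def]
    rw [h.skew_comm]
    have : unitInterval.symm (weightRatio s t hs ht) = weightRatio t s ht hs := by
      refine Subtype.ext ?_
      change 1 - s / (s + t) = t / (t + s)
      field_simp
      ring
    rw [this]
    ext
    · exact add_comm s t
    · rfl

theorem mk_add_mk_self {s t : ℝ} (hs : 0 < s) (ht : 0 < t) (x : A) :
    (⟨s, hs, x⟩ + ⟨t, ht, x⟩ : PosCone h) = ⟨s + t, add_pos hs ht, x⟩ := by
  simp only [add_def, h.idem]

/-- The ray through `x` in the cone over a barycentric algebra. -/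
noncomputable def ray (h : IsBarycentricAlgebra op) (x : A) : ℝ≥0 →+ WithZero (PosCone h) where
  toFun c := if hc : 0 < (c : ℝ) then ((⟨c, hc, x⟩ : PosCone h) : WithZero (PosCone h)) else 0
  map_zero' := by simp
  map_add' c d := by
    rcases eq_zero_or_pos c with rfl | hc
    · simp
    rcases eq_zero_or_pos d with rfl | hd
    · simp
    have hc' : 0 < (c : ℝ) := hc
    have hd' : 0 < (d : ℝ) := hd
    have hcd : 0 < ((c + d : ℝ≥0) : ℝ) := by positivity
    rw [dif_pos hc', dif_pos hd', dif_pos hcd, ← WithZero.coe_add, mk_add_mk_self]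
    rfl

theorem ray_of_pos (h : IsBarycentricAlgebra op) (x : A) {c : ℝ≥0} (hc : 0 < (c : ℝ)) :
    ray h x c = ((⟨c, hc, x⟩ : PosCone h) : WithZero (PosCone h)) := dif_pos hc

/-- The formal combination `∑ w x • f x` in the cone over a barycentric algebra. -/
noncomputable def combination (h : IsBarycentricAlgebra op) {X : Type*} (f : X → A) :
    (X →₀ ℝ≥0) →+ WithZero (PosCone h) :=
  Finsupp.liftAddHom fun x => ray h (f x)

theorem combination_single (h : IsBarycentricAlgebra op) {X : Type*} (f : X → A) (x : X) (c : ℝ≥0) :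
    combination h f (Finsupp.single x c) = ray h (f x) c := by
  simp [combination]

/-- The total weight. -/
noncomputable def totalWeight (h : IsBarycentricAlgebra op) : WithZero (PosCone h) →+ ℝ where
  toFun a := WithZero.recZeroCoe 0 PosCone.weight a
  map_zero' := rfl
  map_add' a b := by
    induction a using WithZero.recZeroCoe with
    | zero => simp
    | coe a =>
      induction b using WithZero.recZeroCoe with
      | zero => simp
      | coe b => rw [← WithZero.coe_add]; simp [add_def]

theorem totalWeight_coe (a : PosCone h) : totalWeight h (a : WithZero (PosCone h)) = a.weight := rfl

theorem totalWeight_ray (x : A) (c : ℝ≥0) : totalWeight h (ray h x c) = c := by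
  rcases eq_zero_or_pos c with rfl | hc
  · simp
  · rw [ray_of_pos h x (c := c) hc, totalWeight_coe]

theorem totalWeight_combination {X : Type*} (f : X → A) (w : X →₀ ℝ≥0) :
    totalWeight h (combination h f w) = ((w.sum fun _ c => c : ℝ≥0) : ℝ) := by
  have : (totalWeight h).comp (combination h f) =
      (NNReal.toRealHom : ℝ≥0 →+ ℝ).comp (Finsupp.liftAddHom fun _ => AddMonoidHom.id ℝ≥0) := by
    refine Finsupp.addHom_ext fun x c => ?_
    simp [combination_single, totalWeight_ray]
  simpa using DFunLike.congr_fun this w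

/-- An element of total weight one is represented by a unique point. -/
theorem exists_point_of_totalWeight_eq_one {a : WithZero (PosCone h)}
    (ha : totalWeight h a = 1) : ∃ x : A, a = ((⟨1, one_pos, x⟩ : PosCone h) :) := by
  induction a using WithZero.recZeroCoe with
  | zero => simp at ha
  | coe a =>
    obtain ⟨s, hs, x⟩ := a
    obtain rfl : s = 1 := ha
    exact ⟨x, rfl⟩

/-- The cone stores the point itself, so identities in the cone descend to `A` without any
cancellation law. -/
theorem coe_mk_injective {s t : ℝ} {hs : 0 < s} {ht : 0 < t} {x y : A}
    (hxy : ((⟨s, hs, x⟩ : PosCone h) : WithZero (PosCone h)) = ((⟨t, ht, y⟩ : PosCone h) :)) :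
    x = y := by
  have := WithZero.coe_inj.1 hxy
  exact congrArg PosCone.point this

theorem exists_combination_eq (h : IsBarycentricAlgebra op) {X : Type*} (f : X → A) (w : X →₀ ℝ≥0)
    (hw : (w.sum fun _ c => c) = 1) :
    ∃ x : A, combination h f w = ((⟨1, one_pos, x⟩ : PosCone h) :) :=
  exists_point_of_totalWeight_eq_one (by rw [totalWeight_combination, hw]; simp)

/-- Affine maps act on cones. -/
noncomputable def map {B : Type*} {opB : I → B → B → B} (h : IsBarycentricAlgebra op)
    (hB : IsBarycentricAlgebra opB) (g : A → B)
    (hg : ∀ r x y, g (op r x y) = opB r (g x) (g y)) :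
    WithZero (PosCone h) →+ WithZero (PosCone hB) where
  toFun a := WithZero.recZeroCoe 0
    (fun a => ((⟨a.weight, a.pos, g a.point⟩ : PosCone hB) : WithZero (PosCone hB))) a
  map_zero' := rfl
  map_add' a b := by
    induction a using WithZero.recZeroCoe with
    | zero => simp
    | coe a =>
      induction b using WithZero.recZeroCoe with
      | zero => simp
      | coe b =>
        rw [← WithZero.coe_add]
        simp only [WithZero.recZeroCoe_coe]
        rw [← WithZero.coe_add]
        simp only [add_def, hg]

theorem map_coe {B : Type*} {opB : I → B → B → B} (hB : IsBarycentricAlgebra opB) (g : A → B)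
    (hg : ∀ r x y, g (op r x y) = opB r (g x) (g y)) (s : ℝ) (hs : 0 < s) (x : A) :
    map h hB g hg ((⟨s, hs, x⟩ : PosCone h) :) = ((⟨s, hs, g x⟩ : PosCone hB) :) := rfl

theorem map_combination {B : Type*} {opB : I → B → B → B} (hB : IsBarycentricAlgebra opB)
    (g : A → B) (hg : ∀ r x y, g (op r x y) = opB r (g x) (g y)) {X : Type*} (f : X → A)
    (w : X →₀ ℝ≥0) : map h hB g hg (combination h f w) = combination hB (g ∘ f) w := by
  have : (map h hB g hg).comp (combination h f) = combination hB (g ∘ f) := by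
    refine Finsupp.addHom_ext fun x c => ?_
    rcases eq_zero_or_pos c with rfl | hc
    · simp
    · have hc' : 0 < (c : ℝ) := hc
      simp only [AddMonoidHom.comp_apply, combination_single, ray_of_pos _ _ hc', map_coe,
        Function.comp_apply]
  exact DFunLike.congr_fun this w

/-- A binary combination of two points, computed in the cone. -/
theorem coe_op (h : IsBarycentricAlgebra op) (r s : ℝ≥0) (hrs : r + s = 1) (q : I)
    (hq : (q : ℝ) = r) (x y : A) :
    ray h x r + ray h y s = ((⟨1, one_pos, op q x y⟩ : PosCone h) :) := by
  have hrs' : (r : ℝ) + s = 1 := by exact_mod_cast hrs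
  -- At the endpoints one of the rays contributes the adjoined zero and the operation is a
  -- projection.
  rcases eq_zero_or_pos r with rfl | hr
  · obtain rfl : s = 1 := by simpa using hrs
    have : q = unitInterval.symm 1 := Subtype.ext (by simp [hq])
    rw [this, ← h.skew_comm, h.one_left, map_zero, zero_add, ray_of_pos h y (by simp)]
    simp
  rcases eq_zero_or_pos s with rfl | hs
  · obtain rfl : r = 1 := by simpa using hrs
    have : q = 1 := Subtype.ext (by simp [hq])
    rw [this, h.one_left, map_zero, add_zero, ray_of_pos h x (by simp)]
    simp
  have hr' : 0 < (r : ℝ) := hr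
  have hs' : 0 < (s : ℝ) := hs
  rw [ray_of_pos h x hr', ray_of_pos h y hs', ← WithZero.coe_add, add_def]
  have : weightRatio r s hr' hs' = q := Subtype.ext (by
    change (r : ℝ) / (r + s) = q
    rw [hrs', div_one, hq])
  simp only [this, hrs']

end PosCone

/-- The scaling of weights of a finite formal combination acts on the combination. -/
theorem PosCone.combination_smul {A : Type*} {op : I → A → A → A} (h : IsBarycentricAlgebra op)
    {X : Type*} (f : X → A) (w : X →₀ ℝ≥0) {x : A}
    (hx : combination h f w = ((⟨1, one_pos, x⟩ : PosCone h) :)) (c : ℝ≥0) :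
    combination h f (c • w) = ray h x c := by
  rcases eq_zero_or_pos c with rfl | hc
  · simp
  have hc' : 0 < (c : ℝ) := hc
  -- Multiplying all weights by `c` leaves their ratios unchanged, so scaling is additive on the
  -- cone.
  let scale : WithZero (PosCone h) →+ WithZero (PosCone h) :=
    { toFun := fun a => WithZero.recZeroCoe 0 (fun a => ((⟨c * a.weight, mul_pos hc' a.pos, a.point⟩ :
        PosCone h) : WithZero (PosCone h))) a
      map_zero' := rfl
      map_add' := fun a b => by
        induction a using WithZero.recZeroCoe with
        | zero => simp
        | coe a =>
          induction b using WithZero.recZeroCoe with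
          | zero => simp
          | coe b =>
            rw [← WithZero.coe_add]
            simp only [WithZero.recZeroCoe_coe]
            rw [← WithZero.coe_add]
            simp only [add_def]
            congr 1
            ext
            · exact mul_add _ _ _
            · have : weightRatio (c * a.weight) (c * b.weight) (mul_pos hc' a.pos)
                  (mul_pos hc' b.pos) = weightRatio a.weight b.weight a.pos b.pos := by
                refine Subtype.ext ?_
                change (c * a.weight) / (c * a.weight + c * b.weight)
                  = a.weight / (a.weight + b.weight)
                rw [← mul_add, mul_div_mul_left _ _ hc'.ne']
              simp only [this] }
  have key : (combination h f).comp (DistribSMul.toAddMonoidHom (X →₀ ℝ≥0) c)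
      = scale.comp (combination h f) := by
    refine Finsupp.addHom_ext fun y d => ?_
    rcases eq_zero_or_pos d with rfl | hd
    · simp
    have hd' : 0 < (d : ℝ) := hd
    have hcd : 0 < ((c * d : ℝ≥0) : ℝ) := by positivity
    simp only [AddMonoidHom.comp_apply, DistribSMul.toAddMonoidHom_apply, Finsupp.smul_single,
      smul_eq_mul, combination_single, ray_of_pos _ _ hd', ray_of_pos _ _ hcd]
    rfl
  have := DFunLike.congr_fun key w
  simp only [AddMonoidHom.comp_apply, DistribSMul.toAddMonoidHom_apply, hx] at this
  rw [this, ray_of_pos h x hc']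
  change ((⟨c * 1, _, x⟩ : PosCone h) : WithZero (PosCone h)) = _
  simp only [mul_one]

theorem PosCone.combination_op {A : Type*} {op : I → A → A → A} (h : IsBarycentricAlgebra op)
    {X : Type*} (f : X → A) (w w' : X →₀ ℝ≥0) {x x' : A}
    (hx : combination h f w = ((⟨1, one_pos, x⟩ : PosCone h) :))
    (hx' : combination h f w' = ((⟨1, one_pos, x'⟩ : PosCone h) :)) (r s : ℝ≥0) (hrs : r + s = 1)
    (q : I) (hq : (q : ℝ) = r) :
    combination h f (r • w + s • w') = ((⟨1, one_pos, op q x x'⟩ : PosCone h) :) := by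
  rw [map_add, combination_smul h f w hx, combination_smul h f w' hx', coe_op h r s hrs q hq]

/-! ### Transport cost between points of the cone -/

/-- Two points of the cone have the same weight, and can be transported to each other at cost
at most `C`. -/
def PosCone.CostLE (p : ℝ) {A : Type*} [EMetricSpace A] {op : I → A → A → A}
    {h : IsBarycentricAlgebra op} (a b : WithZero (PosCone h)) (C : ℝ≥0∞) : Prop :=
  (a = 0 ∧ b = 0) ∨ ∃ (s : ℝ) (hs : 0 < s) (x y : A), a = ((⟨s, hs, x⟩ : PosCone h) :) ∧
    b = ((⟨s, hs, y⟩ : PosCone h) :) ∧ ENNReal.ofReal s * edist x y ^ p ≤ C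

/-- Multiplied by the total weight `s + t`, the Wasserstein inequality says that the costs `s * d ^
p` are subadditive under addition in the cone. -/
theorem PosCone.CostLE.add {p : ℝ} {A : Type*} [EMetricSpace A] {op : I → A → A → A}
    (hW : IsWassersteinAlgebra p op) {a b a' b' : WithZero (PosCone hW.toIsBarycentricAlgebra)}
    {C C' : ℝ≥0∞} (hab : CostLE p a b C) (hab' : CostLE p a' b' C') :
    CostLE p (a + a') (b + b') (C + C') := by
  rcases hab with ⟨rfl, rfl⟩ | ⟨s, hs, x, y, rfl, rfl, hC⟩
  · rw [zero_add, zero_add]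
    rcases hab' with ⟨rfl, rfl⟩ | ⟨t, ht, x', y', rfl, rfl, hC'⟩
    · exact Or.inl ⟨rfl, rfl⟩
    · exact Or.inr ⟨t, ht, x', y', rfl, rfl, hC'.trans le_add_self⟩
  rcases hab' with ⟨rfl, rfl⟩ | ⟨t, ht, x', y', rfl, rfl, hC'⟩
  · exact Or.inr ⟨s, hs, x, y, add_zero _, add_zero _, hC.trans le_self_add⟩
  refine Or.inr ⟨s + t, add_pos hs ht, _, _, (WithZero.coe_add _ _).symm,
    (WithZero.coe_add _ _).symm, ?_⟩
  set r := weightRatio s t hs ht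
  have h1 : (s + t) * (r : ℝ) = s := by
    change (s + t) * (s / (s + t)) = s
    field_simp
  have h2 : (s + t) * (1 - (r : ℝ)) = t := by rw [mul_sub, h1]; ring
  calc ENNReal.ofReal (s + t) * edist (op r x x') (op r y y') ^ p
      ≤ ENNReal.ofReal (s + t) * (ENNReal.ofReal (r : ℝ) * edist x y ^ p +
        ENNReal.ofReal (1 - (r : ℝ)) * edist x' y' ^ p) := by
        gcongr; exact hW.edist_op_rpow_le r x y x' y'
    _ = ENNReal.ofReal s * edist x y ^ p + ENNReal.ofReal t * edist x' y' ^ p := by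
        rw [mul_add, ← mul_assoc, ← mul_assoc, ← ENNReal.ofReal_mul (by positivity),
          ← ENNReal.ofReal_mul (by positivity), h1, h2]
    _ ≤ C + C' := add_le_add hC hC'

/-- This is the Wasserstein inequality for finitely many points, by induction on the atoms of the
transport plan `g`; nonexpansiveness of `f` handles one atom. -/
theorem PosCone.costLE_combination {p : ℝ} (hp : 0 ≤ p) {A : Type*} [EMetricSpace A]
    {op : I → A → A → A} (hW : IsWassersteinAlgebra p op) {X : Type*} [EMetricSpace X] {f : X → A}
    (hf : LipschitzWith 1 f) (g : X × X →₀ ℝ≥0) :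
    CostLE p (combination hW.toIsBarycentricAlgebra f (g.mapDomain Prod.fst))
      (combination hW.toIsBarycentricAlgebra f (g.mapDomain Prod.snd))
      (g.sum fun z c => (c : ℝ≥0∞) * edist z.1 z.2 ^ p) := by
  induction g using Finsupp.induction_linear with
  | zero => exact Or.inl ⟨by simp, by simp⟩
  | add g g' hg hg' =>
    rw [Finsupp.mapDomain_add, Finsupp.mapDomain_add, map_add, map_add, Finsupp.sum_add_index']
    · exact CostLE.add hW hg hg'
    · simp
    · intro z c d
      rw [ENNReal.coe_add, add_mul]
  | single z c =>
    rw [Finsupp.mapDomain_single, Finsupp.mapDomain_single, combination_single,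
      combination_single, Finsupp.sum_single_index (by simp)]
    rcases eq_zero_or_pos c with rfl | hc
    · exact Or.inl ⟨by simp, by simp⟩
    have hc' : 0 < (c : ℝ) := hc
    refine Or.inr ⟨c, hc', _, _, ray_of_pos _ _ hc', ray_of_pos _ _ hc', ?_⟩
    rw [ENNReal.ofReal_coe_nnreal]
    gcongr
    simpa using hf z.1 z.2

/-! ### Couplings -/

theorem exists_coupling_of_wassersteinDist_lt {X : Type*} [MetricSpace X] [MeasurableSpace X] {p : ℝ}
    {μ ν : Measure X} (hp : 0 < p) {C : ℝ≥0∞}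
    (h : wassersteinDist p μ ν < C) :
    ∃ γ : @Measure (X × X) (borel (X × X)), IsCoupling μ ν γ ∧
      @lintegral (X × X) (borel (X × X)) γ (fun z => edist z.1 z.2 ^ p) < C ^ p := by
  rw [wassersteinDist, one_div, ENNReal.rpow_inv_lt_iff hp] at h
  simpa only [iInf_lt_iff, exists_prop] using h

theorem map_val_comap_val {X : Type*} [MeasurableSpace X] {μ : Measure X} {Y : Set X}
    (hY : MeasurableSet Y) (hμ : μ Yᶜ = 0) :
    (μ.comap (Subtype.val : Y → X)).map Subtype.val = μ := by
  rw [(MeasurableEmbedding.subtype_coe hY).map_comap, Subtype.range_coe]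
  exact Measure.restrict_eq_self_of_ae_mem (mem_ae_iff.2 hμ)

theorem isProbabilityMeasure_comap_val {X : Type*} [MeasurableSpace X] {μ : Measure X}
    [IsProbabilityMeasure μ] {Y : Set X}
    (hY : MeasurableSet Y) (hμ : μ Yᶜ = 0) :
    IsProbabilityMeasure (μ.comap (Subtype.val : Y → X)) := by
  refine ⟨?_⟩
  rw [(MeasurableEmbedding.subtype_coe hY).comap_apply, image_univ, Subtype.range_coe,
    ← prob_compl_eq_zero_iff hY, hμ]

section Coupling

variable {X : Type*} [MetricSpace X] [MeasurableSpace X] [BorelSpace X] {p : ℝ}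

/-- Random variables with laws `μ` and `ν` bound the Wasserstein distance. -/
theorem wassersteinDist_map_le {Ω : Type*} [MeasurableSpace Ω] (P : Measure Ω)
    [IsProbabilityMeasure P] (hp : 0 ≤ p) {f g : Ω → X} (hf : StronglyMeasurable f)
    (hg : StronglyMeasurable g) :
    wassersteinDist p (P.map f) (P.map g) ≤ (∫⁻ ω, edist (f ω) (g ω) ^ p ∂P) ^ (1 / p) := by
  let : MeasurableSpace (X × X) := borel (X × X)
  have : BorelSpace (X × X) := ⟨rfl⟩
  -- Strong measurability gives separable ranges, which makes the pair measurable for the Borel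
  -- σ-algebra of the product and not only for the product σ-algebra.
  have hm : Measurable fun ω => (f ω, g ω) := (hf.prodMk hg).measurable
  have hfst : Measurable (Prod.fst : X × X → X) := continuous_fst.measurable
  have hsnd : Measurable (Prod.snd : X × X → X) := continuous_snd.measurable
  refine ENNReal.rpow_le_rpow ?_ (by positivity)
  refine iInf₂_le_of_le (P.map fun ω => (f ω, g ω)) ⟨?_, ?_, ?_⟩ ?_
  · exact Measure.isProbabilityMeasure_map hm.aemeasurable
  · rw [Measure.map_map hfst hm]
    rfl
  · rw [Measure.map_map hsnd hm]
    rfl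
  · exact lintegral_map_le _ _

/-- A coupling of measures that are concentrated on a closed separable set `Y` comes from a
measure on `Y × Y`. -/
theorem exists_coupling_subtype {μ ν : Measure X} (hp : 0 < p) {C : ℝ≥0∞}
    (h : wassersteinDist p μ ν < C) {Y : Set X} (hY : IsClosed Y)
    [SecondCountableTopology Y] (hμ : μ Yᶜ = 0) (hν : ν Yᶜ = 0) :
    ∃ γ : Measure (Y × Y), IsProbabilityMeasure γ ∧
      γ.map Prod.fst = μ.comap (Subtype.val : Y → X) ∧
      γ.map Prod.snd = ν.comap (Subtype.val : Y → X) ∧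
      ∫⁻ z, edist z.1 z.2 ^ p ∂γ < C ^ p := by
  obtain ⟨γ, hγ, hC⟩ := exists_coupling_of_wassersteinDist_lt hp h
  let i : Y × Y → X × X := Prod.map Subtype.val Subtype.val
  have hi : Topology.IsClosedEmbedding i :=
    hY.isClosedEmbedding_subtypeVal.prodMap hY.isClosedEmbedding_subtypeVal
  let : MeasurableSpace (X × X) := borel (X × X)
  have : BorelSpace (X × X) := ⟨rfl⟩
  -- Second countability of `Y` makes the product σ-algebra on `Y × Y` the Borel one, so a closed
  -- embedding is a measurable embedding.
  have hie : MeasurableEmbedding i := hi.measurableEmbedding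
  have hval : MeasurableEmbedding (Subtype.val : Y → X) :=
    MeasurableEmbedding.subtype_coe hY.measurableSet
  have hfst : Measurable (Prod.fst : X × X → X) := continuous_fst.measurable
  have hsnd : Measurable (Prod.snd : X × X → X) := continuous_snd.measurable
  have hrange : γ (range i)ᶜ = 0 := by
    have hsub : (range i)ᶜ ⊆ Prod.fst ⁻¹' Yᶜ ∪ Prod.snd ⁻¹' Yᶜ := by
      intro z hz
      by_contra hcon
      simp only [mem_union, mem_preimage, mem_compl_iff, not_or, not_not] at hcon
      exact hz ⟨(⟨z.1, hcon.1⟩, ⟨z.2, hcon.2⟩), rfl⟩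
    refine measure_mono_null hsub (measure_union_null ?_ ?_)
    · rw [← Measure.map_apply hfst hY.measurableSet.compl]
      exact (congrArg (fun m : Measure X => m Yᶜ) hγ.map_fst).trans hμ
    · rw [← Measure.map_apply hsnd hY.measurableSet.compl]
      exact (congrArg (fun m : Measure X => m Yᶜ) hγ.map_snd).trans hν
  have hmap : (γ.comap i).map i = γ := by
    rw [hie.map_comap]
    exact Measure.restrict_eq_self_of_ae_mem (mem_ae_iff.2 hrange)
  have hprob : IsProbabilityMeasure γ := hγ.isProbabilityMeasure
  refine ⟨γ.comap i, ?_, ?_, ?_, ?_⟩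
  · refine ⟨?_⟩
    rw [hie.comap_apply, image_univ, ← prob_compl_eq_zero_iff hi.isClosed_range.measurableSet]
    exact hrange
  · have : ((γ.comap i).map Prod.fst).map Subtype.val = μ := by
      rw [Measure.map_map hval.measurable measurable_fst]
      refine Eq.trans ?_ hγ.map_fst
      refine Eq.trans ?_ (congrArg (Measure.map Prod.fst) hmap)
      rw [Measure.map_map hfst hie.measurable]
      rfl
    rw [← this, hval.comap_map]
  · have : ((γ.comap i).map Prod.snd).map Subtype.val = ν := by
      rw [Measure.map_map hval.measurable measurable_snd]
      refine Eq.trans ?_ hγ.map_snd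
      refine Eq.trans ?_ (congrArg (Measure.map Prod.snd) hmap)
      rw [Measure.map_map hsnd hie.measurable]
      rfl
    rw [← this, hval.comap_map]
  · refine lt_of_eq_of_lt ?_ hC
    refine Eq.trans ?_ (congrArg (fun m => lintegral m fun z : X × X => edist z.1 z.2 ^ p) hmap)
    rw [hie.lintegral_map]
    rfl

/-- Countably many Radon probability measures are concentrated on a common closed separable set. -/
theorem exists_isClosed_isSeparable_measure_compl (μ : ℕ → Measure X)
    [∀ n, IsProbabilityMeasure (μ n)] (hμ : ∀ n, (μ n).InnerRegular) :
    ∃ Y : Set X, IsClosed Y ∧ TopologicalSpace.IsSeparable Y ∧ ∀ n, μ n Yᶜ = 0 := by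
  -- Each measure is exhausted up to null sets by countably many compact sets, which are separable.
  have key : ∀ n k : ℕ, ∃ K : Set X, IsCompact K ∧ μ n Kᶜ ≤ (k + 1 : ℝ≥0∞)⁻¹ := by
    intro n k
    have hlt : 1 - (k + 1 : ℝ≥0∞)⁻¹ < μ n univ := by
      rw [measure_univ]
      exact ENNReal.sub_lt_self ENNReal.one_ne_top one_ne_zero
        (ENNReal.inv_ne_zero.2 (by finiteness))
    obtain ⟨K, -, hK, hlt⟩ := (hμ n).innerRegular MeasurableSet.univ _ hlt
    refine ⟨K, hK, ?_⟩
    rw [prob_compl_eq_one_sub hK.isClosed.measurableSet]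
    rw [tsub_le_iff_left]
    exact tsub_le_iff_right.1 hlt.le
  choose K hK hKle using key
  refine ⟨closure (⋃ n, ⋃ k, K n k), isClosed_closure, ?_, fun n => ?_⟩
  · exact (TopologicalSpace.IsSeparable.iUnion fun n =>
      TopologicalSpace.IsSeparable.iUnion fun k => (hK n k).isSeparable).closure
  · refine le_antisymm (ENNReal.le_of_forall_pos_le_add fun ε hε _ => ?_) zero_le
    obtain ⟨k, hk⟩ := ENNReal.exists_inv_nat_lt (ENNReal.coe_pos.2 hε).ne'
    rw [zero_add]
    refine le_trans (measure_mono (compl_subset_compl.2 ?_)) ((hKle n k).trans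
      (le_trans (ENNReal.inv_le_inv.2 le_self_add) hk.le))
    exact (subset_iUnion_of_subset n (subset_iUnion (K n) k)).trans subset_closure

/-- Convex combinations of couplings. -/
theorem IsCoupling.convexComb {μ ν μ' ν' : Measure X} {γ γ' : @Measure (X × X) (borel (X × X))}
    (h : IsCoupling μ ν γ) (h' : IsCoupling μ' ν' γ') {a b : ℝ≥0∞} (hab : a + b = 1) :
    IsCoupling (a • μ + b • μ') (a • ν + b • ν') (a • γ + b • γ') := by
  let : MeasurableSpace (X × X) := borel (X × X)
  have : BorelSpace (X × X) := ⟨rfl⟩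
  have hfst : Measurable (Prod.fst : X × X → X) := continuous_fst.measurable
  have hsnd : Measurable (Prod.snd : X × X → X) := continuous_snd.measurable
  refine ⟨⟨?_⟩, ?_, ?_⟩
  · have h1 : γ univ = 1 := h.isProbabilityMeasure.measure_univ
    have h2 : γ' univ = 1 := h'.isProbabilityMeasure.measure_univ
    simp only [Measure.coe_add, Measure.coe_smul, Pi.add_apply, Pi.smul_apply, smul_eq_mul, h1, h2,
      mul_one, hab]
  · rw [← h.map_fst, ← h'.map_fst, ← Measure.map_smul, ← Measure.map_smul]
    exact Measure.map_add _ _ hfst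
  · rw [← h.map_snd, ← h'.map_snd, ← Measure.map_smul, ← Measure.map_smul]
    exact Measure.map_add _ _ hsnd

/-- At Wasserstein distance zero, measures of closed sets compare. -/
theorem measure_isClosed_le_of_wassersteinDist_eq_zero {μ ν : Measure X} [IsProbabilityMeasure ν]
    (hp : 0 < p) (h : wassersteinDist p μ ν = 0) {F : Set X} (hF : IsClosed F) : μ F ≤ ν F := by
  have key : ∀ ε : ℝ, 0 < ε → μ F ≤ ν (Metric.cthickening ε F) := by
    intro ε hε
    refine ENNReal.le_of_forall_pos_le_add fun η hη _ => ?_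
    have hε' : ENNReal.ofReal ε ^ p ≠ 0 := by
      simp [hε]
    have hε'' : ENNReal.ofReal ε ^ p ≠ ∞ := by finiteness
    -- With this cost bound, Markov's inequality leaves mass at most `η` on pairs at distance at
    -- least `ε`; the remaining mass over `F` ends in its `ε`-thickening.
    have hC : wassersteinDist p μ ν < (η * ENNReal.ofReal ε ^ p) ^ (1 / p) := by
      rw [h]
      exact ENNReal.rpow_pos (ENNReal.mul_pos (ENNReal.coe_pos.2 hη).ne' hε') (by finiteness)
    obtain ⟨γ, hγ, hcost⟩ := exists_coupling_of_wassersteinDist_lt hp hC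
    rw [one_div, ENNReal.rpow_inv_rpow hp.ne'] at hcost
    let : MeasurableSpace (X × X) := borel (X × X)
    have : BorelSpace (X × X) := ⟨rfl⟩
    have hfst : Measurable (Prod.fst : X × X → X) := continuous_fst.measurable
    have hsnd : Measurable (Prod.snd : X × X → X) := continuous_snd.measurable
    have hμ : μ F = γ (Prod.fst ⁻¹' F) := by
      rw [← Measure.map_apply hfst hF.measurableSet]
      exact (congrArg (fun m : Measure X => m F) hγ.map_fst).symm
    have hν : ν (Metric.cthickening ε F) = γ (Prod.snd ⁻¹' Metric.cthickening ε F) := by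
      rw [← Measure.map_apply hsnd Metric.isClosed_cthickening.measurableSet]
      exact (congrArg (fun m : Measure X => m _) hγ.map_snd).symm
    have hsub : Prod.fst ⁻¹' F ⊆ Prod.snd ⁻¹' Metric.cthickening ε F ∪
        {z : X × X | ENNReal.ofReal ε ^ p ≤ edist z.1 z.2 ^ p} := by
      intro z hz
      by_cases hd : ENNReal.ofReal ε ^ p ≤ edist z.1 z.2 ^ p
      · exact Or.inr hd
      · refine Or.inl ?_
        rw [ENNReal.rpow_le_rpow_iff hp, not_le, edist_comm] at hd
        exact Metric.mem_cthickening_of_edist_le _ _ _ _ hz hd.le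
    have hmeas : Measurable fun z : X × X => edist z.1 z.2 ^ p :=
      (continuous_fst.edist continuous_snd).measurable.pow_const p
    rw [hμ, hν]
    refine (measure_mono hsub).trans ((measure_union_le _ _).trans (add_le_add_right ?_ _))
    have := mul_meas_ge_le_lintegral (μ := γ) hmeas (ENNReal.ofReal ε ^ p)
    have h2 : ENNReal.ofReal ε ^ p * γ {z : X × X | ENNReal.ofReal ε ^ p ≤ edist z.1 z.2 ^ p} ≤
        ENNReal.ofReal ε ^ p * η := (this.trans hcost.le).trans_eq (mul_comm _ _)
    exact (ENNReal.mul_le_mul_iff_right hε' hε'').1 h2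
  have hlim := tendsto_measure_cthickening_of_isClosed (μ := ν)
    ⟨1, one_pos, measure_ne_top _ _⟩ hF
  refine ge_of_tendsto (hlim.mono_left (nhdsWithin_le_nhds (s := Ioi 0))) ?_
  filter_upwards [self_mem_nhdsWithin] with ε hε using key ε hε

end Coupling

/-! ### Gluing of couplings -/

/-- A sequence of couplings of consecutive measures is realized by a sequence of random
variables. -/
theorem exists_measure_map_pair_eq {Y : Type*} [MeasurableSpace Y] [StandardBorelSpace Y]
    [Nonempty Y] (μ : ℕ → Measure Y) (γ : ℕ → Measure (Y × Y)) [∀ n, IsProbabilityMeasure (γ n)]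
    (hfst : ∀ n, (γ n).map Prod.fst = μ n) (hsnd : ∀ n, (γ n).map Prod.snd = μ (n + 1)) :
    ∃ P : Measure (ℕ → Y), IsProbabilityMeasure P ∧
      ∀ n, P.map (fun ω => (ω n, ω (n + 1))) = γ n := by
  have hprob : ∀ n, IsProbabilityMeasure (μ n) := fun n => by
    rw [← hfst n]
    exact Measure.isProbabilityMeasure_map measurable_fst.aemeasurable
  let last : (n : ℕ) → (Finset.Iic n → Y) → Y := fun n x => x ⟨n, Finset.mem_Iic.2 le_rfl⟩
  have hlast : ∀ n, Measurable (last n) := fun n => measurable_pi_apply _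
  -- The next point is drawn from the conditional law of `γ n` given the present point alone,
  -- ignoring the earlier past.
  let κ : (n : ℕ) → ProbabilityTheory.Kernel (Finset.Iic n → Y) Y :=
    fun n => (γ n).condKernel.comap (last n) (hlast n)
  let P : Measure (ℕ → Y) := ProbabilityTheory.Kernel.trajMeasure (X := fun _ => Y) (μ 0) κ
  have hpair : ∀ n, P.map (fun ω => ω n) = μ n → P.map (fun ω => (ω n, ω (n + 1))) = γ n := by
    intro n hn
    have h1 := ProbabilityTheory.Kernel.map_frestrictLe_trajMeasure_compProd_eq_map_trajMeasure
      (X := fun _ => Y) (κ := κ) (μ₀ := μ 0) (a := n)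
    have h2 := congrArg (Measure.map (Prod.map (last n) id)) h1
    rw [Measure.map_map (by fun_prop) (by fun_prop)] at h2
    refine Eq.trans h2.symm ?_
    have h3 : (P.map (Preorder.frestrictLe (π := fun _ => Y) n)).map (last n) = (γ n).fst := by
      rw [Measure.map_map (hlast n) (by fun_prop), Measure.fst, hfst n]
      exact hn
    have hd := (γ n).disintegrate (γ n).condKernel
    rw [← h3] at hd
    refine Eq.trans ?_ hd
    ext s hs
    have : IsProbabilityMeasure (P.map (Preorder.frestrictLe (π := fun _ => Y) n)) :=
      Measure.isProbabilityMeasure_map (by fun_prop)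
    rw [Measure.map_apply (by fun_prop) hs, Measure.compProd_apply (by measurability),
      Measure.compProd_apply hs, lintegral_map _ (hlast n)]
    · rfl
    · exact ProbabilityTheory.Kernel.measurable_kernel_prodMk_left hs
  refine ⟨P, inferInstance, fun n => hpair n ?_⟩
  induction n with
  | zero =>
    have h0 : P.map (Preorder.frestrictLe (π := fun _ => Y) 0) =
        (μ 0).map (MeasurableEquiv.piUnique fun _ : Finset.Iic 0 => Y).symm := by
      simp only [P, ProbabilityTheory.Kernel.trajMeasure]
      rw [Measure.map_comp _ _ (by fun_prop), ProbabilityTheory.Kernel.traj_map_frestrictLe,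
        ProbabilityTheory.Kernel.partialTraj_self, Measure.id_comp]
    have h1 := congrArg (Measure.map (last 0)) h0
    rw [Measure.map_map (hlast 0) (by fun_prop), Measure.map_map (hlast 0) (by fun_prop)] at h1
    refine Eq.trans h1 ?_
    exact Measure.map_id
  | succ n ih =>
    rw [← hsnd n, ← hpair n ih, Measure.map_map measurable_snd (by fun_prop)]
    rfl

/-! ### The Wasserstein metric -/

/-- The countable Minkowski inequality. -/
theorem lintegral_tsum_rpow_le {Ω : Type*} [MeasurableSpace Ω] {P : Measure Ω} {p : ℝ} (hp : 1 ≤ p)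
    {f : ℕ → Ω → ℝ≥0∞} (hf : ∀ n, Measurable (f n)) :
    (∫⁻ ω, (∑' n, f n ω) ^ p ∂P) ^ (1 / p) ≤ ∑' n, (∫⁻ ω, f n ω ^ p ∂P) ^ (1 / p) := by
  have hp0 : 0 < p := by linarith
  have hfin : ∀ n, (∫⁻ ω, (∑ k ∈ Finset.range n, f k ω) ^ p ∂P) ^ (1 / p) ≤
      ∑ k ∈ Finset.range n, (∫⁻ ω, f k ω ^ p ∂P) ^ (1 / p) := by
    intro n
    induction n with
    | zero => simp [ENNReal.zero_rpow_of_pos, hp0]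
    | succ n ih =>
      simp only [Finset.sum_range_succ]
      refine le_trans (ENNReal.lintegral_Lp_add_le (f := fun ω => ∑ k ∈ Finset.range n, f k ω)
        (g := f n) ?_ (hf n).aemeasurable hp) (add_le_add_left ih _)
      exact (Finset.measurable_fun_sum _ fun k _ => hf k).aemeasurable
  rw [one_div, ENNReal.rpow_inv_le_iff hp0]
  -- Monotone convergence passes from partial sums to the series.
  have hmono : Monotone fun (n : ℕ) (ω : Ω) => (∑ k ∈ Finset.range n, f k ω) ^ p := by
    intro m n hmn ω
    exact ENNReal.rpow_le_rpow (Finset.sum_le_sum_of_subset (Finset.range_mono hmn)) hp0.le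
  have hsup : ∀ ω, (∑' n, f n ω) ^ p = ⨆ n, (∑ k ∈ Finset.range n, f k ω) ^ p := by
    intro ω
    refine (iSup_eq_of_tendsto (fun m n hmn => hmono hmn ω) ?_).symm
    exact (ENNReal.continuous_rpow_const.tendsto _).comp ENNReal.summable.hasSum.tendsto_sum_nat
  simp only [hsup]
  rw [lintegral_iSup (fun n => (Finset.measurable_fun_sum _ fun k _ => hf k).pow_const p) hmono]
  refine iSup_le fun n => ?_
  rw [← ENNReal.rpow_inv_le_iff hp0, ← one_div]
  exact (hfin n).trans (ENNReal.sum_le_tsum _)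

namespace WassersteinSpace

section

variable {X : Type*} [MetricSpace X] [MeasurableSpace X] {p : ℝ}

@[ext] theorem ext {μ ν : WassersteinSpace p X} (h : μ.measure = ν.measure) : μ = ν := by
  cases μ
  cases ν
  congr

instance (μ : WassersteinSpace p X) : IsProbabilityMeasure μ.measure := μ.isProbabilityMeasure

variable [BorelSpace X]

theorem exists_common_support (μ : ℕ → WassersteinSpace p X) :
    ∃ Y : Set X, IsClosed Y ∧ SecondCountableTopology Y ∧ ∀ n, (μ n).measure Yᶜ = 0 := by
  obtain ⟨Y, hY, hsep, hμ⟩ := exists_isClosed_isSeparable_measure_compl (fun n => (μ n).measure)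
    fun n => (μ n).isRadon
  have : TopologicalSpace.SeparableSpace Y := hsep.separableSpace
  exact ⟨Y, hY, UniformSpace.secondCountable_of_separable Y, hμ⟩

theorem stronglyMeasurable_val {Y : Set X} [SecondCountableTopology Y] :
    StronglyMeasurable (Subtype.val : Y → X) :=
  continuous_subtype_val.stronglyMeasurable

/-- The diagonal coupling has cost zero. It is built from `Y` because the inclusion of a separable
set is strongly measurable. -/
theorem wassersteinDist_self (hp : 0 < p) (μ : WassersteinSpace p X) :
    wassersteinDist p μ.measure μ.measure = 0 := by
  obtain ⟨Y, hY, hsc, hμ⟩ := exists_common_support fun _ => μ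
  have hprob := isProbabilityMeasure_comap_val hY.measurableSet (hμ 0)
  have := wassersteinDist_map_le (μ.measure.comap (Subtype.val : Y → X)) hp.le
    stronglyMeasurable_val stronglyMeasurable_val
  rw [map_val_comap_val hY.measurableSet (hμ 0)] at this
  simpa [hp] using this

theorem wassersteinDist_comm_le (hp : 0 < p) (μ ν : WassersteinSpace p X) :
    wassersteinDist p μ.measure ν.measure ≤ wassersteinDist p ν.measure μ.measure := by
  obtain ⟨Y, hY, hsc, hμ⟩ := exists_common_support fun n => if n = 0 then μ else ν
  have hμ0 : μ.measure Yᶜ = 0 := by simpa using hμ 0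
  have hν0 : ν.measure Yᶜ = 0 := by simpa using hμ 1
  refine le_of_forall_gt fun C hC => ?_
  obtain ⟨γ, hγ, hfst, hsnd, hcost⟩ := exists_coupling_subtype hp hC hY hν0 hμ0
  have := wassersteinDist_map_le γ hp.le (stronglyMeasurable_val.comp_measurable measurable_snd)
    (stronglyMeasurable_val.comp_measurable measurable_fst)
  rw [← Measure.map_map measurable_subtype_coe measurable_snd,
    ← Measure.map_map measurable_subtype_coe measurable_fst, hfst, hsnd,
    map_val_comap_val hY.measurableSet hμ0, map_val_comap_val hY.measurableSet hν0] at this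
  refine this.trans_lt ?_
  rw [one_div, ENNReal.rpow_inv_lt_iff hp]
  simpa only [Function.comp_apply, Subtype.edist_eq, edist_comm] using hcost

/-- By symmetry the two measures agree on closed sets, a π-system generating the Borel sets. -/
theorem eq_of_wassersteinDist_eq_zero (hp : 0 < p) {μ ν : WassersteinSpace p X}
    (h : wassersteinDist p μ.measure ν.measure = 0) : μ = ν := by
  have h' : wassersteinDist p ν.measure μ.measure = 0 :=
    le_antisymm ((wassersteinDist_comm_le hp ν μ).trans h.le) zero_le
  refine WassersteinSpace.ext ?_
  refine ext_of_generate_finite _ (BorelSpace.measurable_eq.trans borel_eq_generateFrom_isClosed)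
    isPiSystem_isClosed (fun F hF => ?_) (by simp)
  exact le_antisymm (measure_isClosed_le_of_wassersteinDist_eq_zero hp h hF)
    (measure_isClosed_le_of_wassersteinDist_eq_zero hp h' hF)

variable [CompleteSpace X]

/-- Near-optimal couplings of consecutive terms of a sequence are realized by a sequence of random
variables with values in a closed separable subset. -/
theorem exists_random_sequence (hp : 0 < p) (μ : ℕ → WassersteinSpace p X) (C : ℕ → ℝ≥0∞)
    (hC : ∀ n, wassersteinDist p (μ n).measure (μ (n + 1)).measure < C n) :
    ∃ Y : Set X, IsClosed Y ∧ SecondCountableTopology Y ∧ Nonempty Y ∧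
      ∃ P : Measure (ℕ → Y), IsProbabilityMeasure P ∧
        (∀ n, P.map (fun ω => (ω n : X)) = (μ n).measure) ∧
        ∀ n, (∫⁻ ω, edist (ω n) (ω (n + 1)) ^ p ∂P) ^ (1 / p) < C n := by
  obtain ⟨Y, hY, hsc, hμ⟩ := exists_common_support μ
  have hcomp : CompleteSpace Y := hY.completeSpace_coe
  have hpr : ∀ n, IsProbabilityMeasure ((μ n).measure.comap (Subtype.val : Y → X)) :=
    fun n => isProbabilityMeasure_comap_val hY.measurableSet (hμ n)
  have hne : Nonempty Y :=
    nonempty_of_isProbabilityMeasure ((μ 0).measure.comap (Subtype.val : Y → X))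
  choose γ hγ hfst hsnd hcost using fun n =>
    exists_coupling_subtype hp (hC n) hY (hμ n) (hμ (n + 1))
  obtain ⟨P, hP, hPγ⟩ := exists_measure_map_pair_eq _ γ hfst hsnd
  refine ⟨Y, hY, hsc, hne, P, hP, fun n => ?_, fun n => ?_⟩
  · rw [← map_val_comap_val hY.measurableSet (hμ n), ← hfst n, ← hPγ n,
      Measure.map_map measurable_fst (by fun_prop),
      Measure.map_map measurable_subtype_coe (by fun_prop)]
    rfl
  · have hm : Measurable fun z : Y × Y => edist z.1 z.2 ^ p :=
      (measurable_fst.edist measurable_snd).pow_const p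
    rw [one_div, ENNReal.rpow_inv_lt_iff hp]
    refine lt_of_eq_of_lt ?_ (hcost n)
    rw [← hPγ n, lintegral_map hm (by fun_prop)]

theorem wassersteinDist_triangle (hp : 1 ≤ p) (μ ν ρ : WassersteinSpace p X) :
    wassersteinDist p μ.measure ρ.measure ≤
      wassersteinDist p μ.measure ν.measure + wassersteinDist p ν.measure ρ.measure := by
  have hp0 : 0 < p := by linarith
  rcases eq_or_ne (wassersteinDist p μ.measure ν.measure) ∞ with h1 | h1
  · simp [h1]
  rcases eq_or_ne (wassersteinDist p ν.measure ρ.measure) ∞ with h2 | h2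
  · simp [h2]
  refine ENNReal.le_of_forall_pos_le_add fun ε hε _ => ?_
  have hε2 : ((ε / 2 : ℝ≥0) : ℝ≥0∞) ≠ 0 := by simpa using hε.ne'
  -- The constant tail is harmless, its consecutive distances being zero; only the first two steps
  -- of the chain are used.
  let m : ℕ → WassersteinSpace p X := fun n => match n with
    | 0 => μ
    | 1 => ν
    | _ => ρ
  obtain ⟨Y, hY, hsc, hne, P, hP, hmap, hdist⟩ := exists_random_sequence hp0 m
    (fun n => wassersteinDist p (m n).measure (m (n + 1)).measure + (ε / 2 : ℝ≥0)) (fun n => by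
      refine ENNReal.lt_add_right ?_ hε2
      match n with
      | 0 => exact h1
      | 1 => exact h2
      | n + 2 =>
        change wassersteinDist p ρ.measure ρ.measure ≠ ∞
        simp [wassersteinDist_self hp0])
  have hm : ∀ n, StronglyMeasurable fun ω : ℕ → Y => (ω n : X) := fun n =>
    stronglyMeasurable_val.comp_measurable (measurable_pi_apply n)
  have hle := wassersteinDist_map_le P hp0.le (hm 0) (hm 2)
  rw [hmap 0, hmap 2] at hle
  have hd : ∀ i j : ℕ, Measurable fun ω : ℕ → Y => edist (ω i) (ω j) := fun i j =>
    (measurable_pi_apply i).edist (measurable_pi_apply j)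
  calc wassersteinDist p μ.measure ρ.measure
      ≤ (∫⁻ ω, edist (ω 0 : X) (ω 2) ^ p ∂P) ^ (1 / p) := hle
    _ ≤ (∫⁻ ω, (edist (ω 0) (ω 1) + edist (ω 1) (ω 2)) ^ p ∂P) ^ (1 / p) := by
        refine ENNReal.rpow_le_rpow (lintegral_mono fun ω => ?_) (by positivity)
        exact ENNReal.rpow_le_rpow (edist_triangle (ω 0) (ω 1) (ω 2)) hp0.le
    _ ≤ (∫⁻ ω, edist (ω 0) (ω 1) ^ p ∂P) ^ (1 / p) +
          (∫⁻ ω, edist (ω 1) (ω 2) ^ p ∂P) ^ (1 / p) :=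
        ENNReal.lintegral_Lp_add_le (hd 0 1).aemeasurable (hd 1 2).aemeasurable hp
    _ ≤ (wassersteinDist p μ.measure ν.measure + (ε / 2 : ℝ≥0)) +
          (wassersteinDist p ν.measure ρ.measure + (ε / 2 : ℝ≥0)) :=
        add_le_add (hdist 0).le (hdist 1).le
    _ = _ := by
        rw [add_add_add_comm, ← ENNReal.coe_add, add_halves]

/-- The Wasserstein metric on `P_p(X)`. -/
noncomputable abbrev emetricSpace (hp : 1 ≤ p) : EMetricSpace (WassersteinSpace p X) where
  edist μ ν := wassersteinDist p μ.measure ν.measure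
  edist_self μ := wassersteinDist_self (by linarith) μ
  edist_comm μ ν := le_antisymm (wassersteinDist_comm_le (by linarith) μ ν)
    (wassersteinDist_comm_le (by linarith) ν μ)
  edist_triangle := wassersteinDist_triangle hp
  eq_of_edist_eq_zero := eq_of_wassersteinDist_eq_zero (by linarith)

/-- A sequence with summable distances of consecutive terms has a limit. -/
theorem exists_wassersteinDist_le_tsum (hp : 1 ≤ p) (μ : ℕ → WassersteinSpace p X) (C : ℕ → ℝ≥0∞)
    (hC : ∀ n, wassersteinDist p (μ n).measure (μ (n + 1)).measure < C n) (hsum : ∑' n, C n ≠ ∞) :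
    ∃ ν : WassersteinSpace p X,
      ∀ n, wassersteinDist p (μ n).measure ν.measure ≤ ∑' k, C (n + k) := by
  have hp0 : 0 < p := by linarith
  obtain ⟨Y, hY, hsc, hne, P, hP, hmap, hdist⟩ := exists_random_sequence hp0 μ C hC
  have hcomp : CompleteSpace Y := hY.completeSpace_coe
  have hd : ∀ i : ℕ, Measurable fun ω : ℕ → Y => edist (ω i) (ω (i + 1)) := fun i =>
    (measurable_pi_apply i).edist (measurable_pi_apply (i + 1))
  have htail : ∀ n, (∫⁻ ω, (∑' k, edist (ω (n + k)) (ω (n + k + 1))) ^ p ∂P) ^ (1 / p) ≤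
      ∑' k, C (n + k) := fun n =>
    (lintegral_tsum_rpow_le hp fun k => hd (n + k)).trans
      (ENNReal.tsum_le_tsum fun k => (hdist (n + k)).le)
  -- The length of a random path has finite `p`-th moment, so it is almost surely finite and almost
  -- every path is Cauchy.
  have hae : ∀ᵐ ω ∂P, ∃ y : Y, Filter.Tendsto (fun n => ω n) Filter.atTop (nhds y) := by
    have h0 : ∫⁻ ω, (∑' k, edist (ω k) (ω (k + 1))) ^ p ∂P ≠ ∞ := by
      intro htop
      have := htail 0
      simp only [zero_add] at this
      rw [htop, ENNReal.top_rpow_of_pos (by positivity), top_le_iff] at this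
      exact hsum this
    have hm : Measurable fun ω : ℕ → Y => (∑' k, edist (ω k) (ω (k + 1))) ^ p :=
      (Measurable.tsum hd).pow_const p
    filter_upwards [ae_lt_top hm h0] with ω hω
    refine cauchySeq_tendsto_of_complete (cauchySeq_of_edist_le_of_tsum_ne_top _
      (fun n => le_rfl) fun htop => ?_)
    rw [htop, ENNReal.top_rpow_of_pos hp0] at hω
    exact lt_irrefl _ hω
  obtain ⟨Z, hZ, hlim⟩ := measurable_limit_of_tendsto_metrizable_ae
    (f := fun (n : ℕ) (ω : ℕ → Y) => ω n) (fun n => (measurable_pi_apply n).aemeasurable) hae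
  have hZX : StronglyMeasurable fun ω => (Z ω : X) := stronglyMeasurable_val.comp_measurable hZ
  have hle : ∀ n, (∫⁻ ω, edist (ω n : X) (Z ω) ^ p ∂P) ^ (1 / p) ≤ ∑' k, C (n + k) := by
    intro n
    refine le_trans (ENNReal.rpow_le_rpow (lintegral_mono_ae ?_) (by positivity)) (htail n)
    filter_upwards [hlim] with ω hω
    exact ENNReal.rpow_le_rpow
      (edist_le_tsum_of_edist_le_of_tendsto _ (fun n => le_rfl) hω n) hp0.le
  have hm : ∀ n, StronglyMeasurable fun ω : ℕ → Y => (ω n : X) := fun n =>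
    stronglyMeasurable_val.comp_measurable (measurable_pi_apply n)
  have hlaw : (P.map Z).map Subtype.val = P.map fun ω => (Z ω : X) := by
    rw [Measure.map_map measurable_subtype_coe hZ]
    rfl
  have hprob : IsProbabilityMeasure (P.map fun ω => (Z ω : X)) :=
    Measure.isProbabilityMeasure_map hZX.measurable.aemeasurable
  let ν : WassersteinSpace p X :=
    { measure := P.map fun ω => (Z ω : X)
      isProbabilityMeasure := hprob
      -- The law of `Z` on the Polish space `Y` is Radon, and continuous images preserve this.
      isRadon := by
        rw [← hlaw]
        exact Measure.InnerRegular.map_of_continuous continuous_subtype_val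
      hasFiniteMoment := by
        obtain ⟨x₀, h₀⟩ := (μ 0).hasFiniteMoment
        refine ⟨x₀, ?_⟩
        refine lt_of_le_of_lt (lintegral_map_le _ _) ?_
        refine lt_of_le_of_lt (lintegral_mono (g := fun ω : ℕ → Y =>
          ((fun ω : ℕ → Y => edist x₀ (ω 0 : X)) + fun ω => edist (ω 0 : X) (Z ω)) ω ^ p)
          fun ω : ℕ → Y => ENNReal.rpow_le_rpow (edist_triangle x₀ (ω 0 : X) (Z ω)) hp0.le) ?_
        have hm0 : Measurable fun ω : ℕ → Y => edist x₀ (ω 0 : X) :=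
          (continuous_const.edist continuous_id).measurable.comp (hm 0).measurable
        refine ENNReal.lintegral_rpow_add_lt_top_of_lintegral_rpow_lt_top hm0.aemeasurable ?_ ?_ hp
        · rw [← hmap 0] at h₀
          rwa [lintegral_map ((continuous_const.edist continuous_id').measurable.pow_const p)
            (hm 0).measurable] at h₀
        · have := (hle 0).trans_lt (by simpa using hsum.lt_top)
          rwa [one_div, ENNReal.rpow_inv_lt_iff hp0, ENNReal.top_rpow_of_pos hp0] at this }
  refine ⟨ν, fun n => ?_⟩
  rw [← hmap n]
  exact (wassersteinDist_map_le P hp0.le (hm n) hZX).trans (hle n)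

theorem completeSpace (hp : 1 ≤ p) :
    @CompleteSpace (WassersteinSpace p X) (emetricSpace hp).toUniformSpace := by
  let _ : EMetricSpace (WassersteinSpace p X) := emetricSpace hp
  let C : ℕ → ℝ≥0∞ := fun n => (2⁻¹ : ℝ≥0∞) ^ n
  have hsum : ∑' n, C n = 2 := by
    simp only [C]
    rw [ENNReal.tsum_geometric, ENNReal.one_sub_inv_two, inv_inv]
  refine EMetric.complete_of_convergent_controlled_sequences C
    (fun n => ENNReal.pow_pos (by simp) n) fun μ hμ => ?_
  obtain ⟨ν, hν⟩ := exists_wassersteinDist_le_tsum hp μ C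
    (fun n => hμ n n (n + 1) le_rfl n.le_succ) (by rw [hsum]; simp)
  refine ⟨ν, tendsto_iff_edist_tendsto_0.2 ?_⟩
  refine tendsto_of_tendsto_of_tendsto_of_le_of_le tendsto_const_nhds ?_ (fun _ => zero_le) hν
  exact (ENNReal.tendsto_sum_nat_add C (by rw [hsum]; simp)).congr fun n =>
    tsum_congr fun k => by rw [add_comm]

end

end WassersteinSpace

/-! ### Finitely supported measures -/

/-- The measure `∑ w z • δ_z` of a finitely supported weight function. -/
noncomputable def finsuppMeasure (Z : Type*) [MeasurableSpace Z] : (Z →₀ ℝ≥0) →+ Measure Z :=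
  Finsupp.liftAddHom fun z =>
    { toFun := fun c => (c : ℝ≥0∞) • Measure.dirac z
      map_zero' := by simp
      map_add' := fun c d => by rw [ENNReal.coe_add, add_smul] }

theorem finsuppMeasure_single {Z : Type*} [MeasurableSpace Z] (z : Z) (c : ℝ≥0) :
    finsuppMeasure Z (Finsupp.single z c) = (c : ℝ≥0∞) • Measure.dirac z := by
  simp [finsuppMeasure]

theorem finsuppMeasure_map {Z Z' : Type*} [MeasurableSpace Z] [MeasurableSpace Z'] {g : Z → Z'}
    (hg : Measurable g) (w : Z →₀ ℝ≥0) :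
    (finsuppMeasure Z w).map g = finsuppMeasure Z' (w.mapDomain g) := by
  induction w using Finsupp.induction_linear with
  | zero => simp
  | add w w' hw hw' => rw [map_add, Measure.map_add _ _ hg, hw, hw', Finsupp.mapDomain_add, map_add]
  | single z c =>
    rw [Finsupp.mapDomain_single, finsuppMeasure_single, finsuppMeasure_single, Measure.map_smul,
      Measure.map_dirac' hg]

theorem lintegral_finsuppMeasure {Z : Type*} [MeasurableSpace Z] [MeasurableSingletonClass Z]
    (w : Z →₀ ℝ≥0) (φ : Z → ℝ≥0∞) :
    ∫⁻ z, φ z ∂finsuppMeasure Z w = w.sum fun z c => (c : ℝ≥0∞) * φ z := by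
  induction w using Finsupp.induction_linear with
  | zero => simp
  | add w w' hw hw' =>
    rw [map_add, lintegral_add_measure, hw, hw', Finsupp.sum_add_index' (by simp)]
    intro z c d
    rw [ENNReal.coe_add, add_mul]
  | single z c =>
    rw [finsuppMeasure_single, lintegral_smul_measure, lintegral_dirac,
      Finsupp.sum_single_index (by simp)]
    rfl

theorem finsuppMeasure_singleton {Z : Type*} [MeasurableSpace Z] [MeasurableSingletonClass Z]
    (w : Z →₀ ℝ≥0) (z : Z) : finsuppMeasure Z w {z} = w z := by
  classical
  induction w using Finsupp.induction_linear with
  | zero => simp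
  | add w w' hw hw' => simp [hw, hw']
  | single y c =>
    rw [finsuppMeasure_single, Measure.smul_apply, Measure.dirac_apply, Finsupp.single_apply]
    by_cases h : y = z <;> simp [h]

theorem finsuppMeasure_injective {Z : Type*} [MeasurableSpace Z] [MeasurableSingletonClass Z] :
    Function.Injective (finsuppMeasure Z) := by
  intro w w' h
  ext z
  have := congrArg (fun m : Measure Z => m {z}) h
  simp only [finsuppMeasure_singleton] at this
  exact_mod_cast this

theorem finsuppMeasure_univ {Z : Type*} [MeasurableSpace Z] (w : Z →₀ ℝ≥0) :
    finsuppMeasure Z w univ = ((w.sum fun _ c => c : ℝ≥0) : ℝ≥0∞) := by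
  induction w using Finsupp.induction_linear with
  | zero => simp
  | add w w' hw hw' => simp [hw, hw', Finsupp.sum_add_index']
  | single z c => simp [finsuppMeasure_single]

theorem finsuppMeasure_compl_support {Z : Type*} [MeasurableSpace Z] [MeasurableSingletonClass Z]
    (w : Z →₀ ℝ≥0) : finsuppMeasure Z w (w.support : Set Z)ᶜ = 0 := by
  rw [← lintegral_indicator_one w.support.measurableSet.compl, lintegral_finsuppMeasure]
  refine Finset.sum_eq_zero fun z hz => ?_
  simp [Finsupp.mem_support_iff.1 hz]

/-- A finite measure concentrated on a finite set is finitely supported. -/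
theorem exists_finsuppMeasure_eq {Z : Type*} [MeasurableSpace Z] [MeasurableSingletonClass Z]
    (γ : Measure Z) [IsFiniteMeasure γ] (S : Finset Z) (hS : γ (S : Set Z)ᶜ = 0) :
    ∃ g : Z →₀ ℝ≥0, γ = finsuppMeasure Z g := by
  refine ⟨∑ z ∈ S, Finsupp.single z (γ {z}).toNNReal, ?_⟩
  rw [map_sum]
  simp only [finsuppMeasure_single]
  ext A hA
  rw [Measure.finsetSum_apply]
  have h1 : γ A = γ (A ∩ S) := (measure_inter_conull hS).symm
  have h2 : A ∩ S = ⋃ z ∈ S, (A ∩ {z}) := by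
    ext x
    simp only [mem_inter_iff, Finset.mem_coe, mem_iUnion, mem_singleton_iff, exists_prop]
    constructor
    · rintro ⟨hx, hxS⟩
      exact ⟨x, hxS, hx, rfl⟩
    · rintro ⟨z, hz, hx, rfl⟩
      exact ⟨hx, hz⟩
  rw [h1, h2, measure_biUnion_finset]
  · refine Finset.sum_congr rfl fun z _ => ?_
    rw [Measure.smul_apply, Measure.dirac_apply' _ hA,
      ENNReal.coe_toNNReal (measure_ne_top _ _)]
    by_cases hz : z ∈ A
    · rw [inter_eq_right.2 (singleton_subset_iff.2 hz)]
      simp [hz]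
    · rw [inter_singleton_eq_empty.2 hz]
      simp [hz]
  · intro x _ y _ hxy
    exact Disjoint.mono inter_subset_right inter_subset_right (by simpa using hxy)
  · exact fun z _ => hA.inter (measurableSet_singleton z)

/-! ### The Wasserstein algebra structure on `P_p(X)` -/

namespace WassersteinSpace

section Algebra

variable {X : Type*} [MetricSpace X] [MeasurableSpace X] {p : ℝ}

theorem convexComb_measure (hp : 1 ≤ p) (r : I) (μ ν : WassersteinSpace p X) :
    (convexComb hp r μ ν).measure =
      ENNReal.ofReal (r : ℝ) • μ.measure + ENNReal.ofReal (1 - (r : ℝ)) • ν.measure := rfl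


theorem isBarycentricAlgebra (hp : 1 ≤ p) :
    IsBarycentricAlgebra (convexComb (X := X) hp) where
  one_left μ ν := by
    ext1
    simp [convexComb_measure]
  idem r μ := by
    ext1
    rw [convexComb_measure, ← add_smul, ← ENNReal.ofReal_add r.2.1 (by linarith [r.2.2])]
    simp
  skew_comm r μ ν := by
    ext1
    rw [convexComb_measure, convexComb_measure, add_comm]
    simp
  skew_assoc s r q hr hs hq μ ν ρ := by
    have hr' : (r : ℝ) < 1 := hr
    have hs' : (s : ℝ) < 1 := hs
    have hr0 : 0 ≤ (r : ℝ) := r.2.1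
    have hs0 : 0 ≤ (s : ℝ) := s.2.1
    have hsr : (s : ℝ) * r < 1 := by nlinarith
    have hpos : 0 < 1 - (s : ℝ) * r := by linarith
    -- `hq1` and `hq2` match the weights of `ν` and `ρ` on the two sides.
    have hq1 : (1 - (s : ℝ) * r) * q = r * (1 - s) := by
      rw [hq]
      field_simp
    have hq2 : (1 - (s : ℝ) * r) * (1 - q) = 1 - r := by
      rw [mul_sub, hq1]
      ring
    ext1
    simp only [convexComb_measure, smul_add, smul_smul]
    rw [← ENNReal.ofReal_mul hr0, ← ENNReal.ofReal_mul hr0, Set.Icc.coe_mul,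
      ← ENNReal.ofReal_mul hpos.le, ← ENNReal.ofReal_mul hpos.le, hq1, hq2, mul_comm (r : ℝ) s,
      add_assoc]

variable [BorelSpace X]

theorem wassersteinDist_dirac_lt_top (hp : 1 ≤ p) (μ : WassersteinSpace p X) (x : X) :
    wassersteinDist p μ.measure (dirac hp x).measure < ∞ := by
  have hp0 : 0 < p := by linarith
  obtain ⟨Y, hY, hsc, hμ⟩ := exists_common_support fun _ => μ
  have hprob := isProbabilityMeasure_comap_val hY.measurableSet (hμ 0)
  have hle := wassersteinDist_map_le (p := p) (μ.measure.comap (Subtype.val : Y → X)) hp0.le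
    stronglyMeasurable_val (stronglyMeasurable_const (b := x))
  rw [map_val_comap_val hY.measurableSet (hμ 0), Measure.map_const, measure_univ, one_smul] at hle
  refine hle.trans_lt ?_
  rw [one_div, ENNReal.rpow_inv_lt_iff hp0, ENNReal.top_rpow_of_pos hp0]
  have := μ.hasFiniteMoment.basepoint hp x
  rw [← map_val_comap_val hY.measurableSet (hμ 0),
    lintegral_map ((continuous_const.edist continuous_id').measurable.pow_const p)
      measurable_subtype_coe] at this
  simpa only [edist_comm x] using this

variable [CompleteSpace X]

/-- Finiteness allows couplings to be chosen with cost within any `ε > 0` of the infimum. -/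
theorem wassersteinDist_lt_top (hp : 1 ≤ p) (μ ν : WassersteinSpace p X) :
    wassersteinDist p μ.measure ν.measure < ∞ := by
  obtain ⟨x⟩ := nonempty_of_isProbabilityMeasure μ.measure
  refine (wassersteinDist_triangle hp μ (dirac hp x) ν).trans_lt (ENNReal.add_lt_top.2
    ⟨wassersteinDist_dirac_lt_top hp μ x, ?_⟩)
  exact (wassersteinDist_comm_le (by linarith) _ _).trans_lt (wassersteinDist_dirac_lt_top hp ν x)

/-- Near-optimal couplings are mixed with weights `r` and `1 - r`; the cost is linear in the
coupling. -/
theorem wassersteinDist_convexComb_rpow_le (hp : 1 ≤ p) (r : I) (μ μ' ν ν' : WassersteinSpace p X) :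
    wassersteinDist p (convexComb hp r μ ν).measure (convexComb hp r μ' ν').measure ^ p ≤
      ENNReal.ofReal (r : ℝ) * wassersteinDist p μ.measure μ'.measure ^ p +
        ENNReal.ofReal (1 - (r : ℝ)) * wassersteinDist p ν.measure ν'.measure ^ p := by
  have hp0 : 0 < p := by linarith
  have hsum : ENNReal.ofReal (r : ℝ) + ENNReal.ofReal (1 - (r : ℝ)) = 1 := by
    rw [← ENNReal.ofReal_add r.2.1 (by linarith [r.2.2])]
    simp
  have key : ∀ (μ ν : WassersteinSpace p X) (ε : ℝ≥0), 0 < ε →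
      ∃ γ : @Measure (X × X) (borel (X × X)), IsCoupling μ.measure ν.measure γ ∧
        @lintegral (X × X) (borel (X × X)) γ (fun z => edist z.1 z.2 ^ p) ≤
          wassersteinDist p μ.measure ν.measure ^ p + ε := by
    intro μ ν ε hε
    obtain ⟨γ, hγ, hC⟩ := exists_coupling_of_wassersteinDist_lt (μ := μ.measure) (ν := ν.measure)
      (C := (wassersteinDist p μ.measure ν.measure ^ p + ε) ^ (1 / p)) hp0 (by
        rw [one_div, ENNReal.lt_rpow_inv_iff hp0]
        exact ENNReal.lt_add_right (by
          have := wassersteinDist_lt_top hp μ ν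
          finiteness) (ENNReal.coe_pos.2 hε).ne')
    rw [one_div, ENNReal.rpow_inv_rpow hp0.ne'] at hC
    exact ⟨γ, hγ, hC.le⟩
  refine ENNReal.le_of_forall_pos_le_add fun ε hε _ => ?_
  obtain ⟨γ, hγ, hC⟩ := key μ μ' ε hε
  obtain ⟨γ', hγ', hC'⟩ := key ν ν' ε hε
  have hle : wassersteinDist p (convexComb hp r μ ν).measure (convexComb hp r μ' ν').measure ^ p ≤
      @lintegral (X × X) (borel (X × X)) (ENNReal.ofReal (r : ℝ) • γ +
        ENNReal.ofReal (1 - (r : ℝ)) • γ') (fun z => edist z.1 z.2 ^ p) := by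
    rw [wassersteinDist, one_div, ENNReal.rpow_inv_rpow hp0.ne']
    exact iInf₂_le _ (hγ.convexComb hγ' hsum)
  refine hle.trans ?_
  rw [lintegral_add_measure, lintegral_smul_measure, lintegral_smul_measure]
  simp only [smul_eq_mul]
  refine (add_le_add (mul_le_mul_right hC _) (mul_le_mul_right hC' _)).trans_eq ?_
  rw [mul_add, mul_add, add_add_add_comm, ← add_mul, hsum, one_mul]

theorem isWassersteinAlgebra (hp : 1 ≤ p) :
    @IsWassersteinAlgebra p (WassersteinSpace p X) (emetricSpace hp) (convexComb hp) := by
  let _ : EMetricSpace (WassersteinSpace p X) := emetricSpace hp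
  refine ⟨isBarycentricAlgebra hp, fun r z z' => ?_, fun r μ μ' ν ν' =>
    wassersteinDist_convexComb_rpow_le hp r μ μ' ν ν'⟩
  have hp0 : 0 < p := by linarith
  rw [ENNReal.coe_one, one_mul, ← ENNReal.rpow_le_rpow_iff hp0]
  refine (wassersteinDist_convexComb_rpow_le hp r z.1 z'.1 z.2 z'.2).trans ?_
  have h1 : edist z.1 z'.1 ^ p ≤ edist z z' ^ p := ENNReal.rpow_le_rpow (le_max_left _ _) hp0.le
  have h2 : edist z.2 z'.2 ^ p ≤ edist z z' ^ p := ENNReal.rpow_le_rpow (le_max_right _ _) hp0.le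
  refine (add_le_add (mul_le_mul_right h1 _) (mul_le_mul_right h2 _)).trans_eq ?_
  rw [← add_mul, ← ENNReal.ofReal_add r.2.1 (by linarith [r.2.2])]
  simp

theorem lipschitzWith_dirac (hp : 1 ≤ p) :
    @LipschitzWith X (WassersteinSpace p X) _ (emetricSpace hp).toPseudoEMetricSpace 1
      (dirac hp) := by
  let _ : EMetricSpace (WassersteinSpace p X) := emetricSpace hp
  intro x y
  have hp0 : 0 < p := by linarith
  -- Constant random variables on a one-point space couple the two Dirac measures.
  have := wassersteinDist_map_le (p := p) (Measure.dirac ()) hp0.le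
    (stronglyMeasurable_const (b := x)) (stronglyMeasurable_const (b := y))
  rw [Measure.map_const, Measure.map_const, measure_univ, one_smul, one_smul, lintegral_const,
    measure_univ, mul_one, one_div, ENNReal.rpow_rpow_inv hp0.ne'] at this
  simpa using! this

end Algebra

end WassersteinSpace

namespace WassersteinSpace

/-! ### Finitely supported measures are dense -/

section Dense

variable {X : Type*} [MetricSpace X] [MeasurableSpace X] [BorelSpace X] {p : ℝ}

/-- The measure represented by a point of the cone over `P_p(X)`. -/
noncomputable def coneMeasure (hp : 1 ≤ p) :
    WithZero (PosCone (isBarycentricAlgebra (X := X) hp)) →+ Measure X where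
  toFun a := WithZero.recZeroCoe 0 (fun a => ENNReal.ofReal a.weight • a.point.measure) a
  map_zero' := rfl
  map_add' a b := by
    induction a using WithZero.recZeroCoe with
    | zero => simp
    | coe a =>
      induction b using WithZero.recZeroCoe with
      | zero => simp
      | coe b =>
        rw [← WithZero.coe_add]
        obtain ⟨s, hs, μ⟩ := a
        obtain ⟨t, ht, ν⟩ := b
        simp only [WithZero.recZeroCoe_coe, PosCone.add_def, convexComb_measure, smul_add, smul_smul]
        have hst : 0 ≤ s + t := by positivity
        have h1 : (s + t) * (s / (s + t)) = s := by field_simp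
        have h2 : (s + t) * (1 - s / (s + t)) = t := by rw [mul_sub, h1]; ring
        rw [← ENNReal.ofReal_mul hst, ← ENNReal.ofReal_mul hst]
        change ENNReal.ofReal ((s + t) * (s / (s + t))) • μ.measure +
          ENNReal.ofReal ((s + t) * (1 - s / (s + t))) • ν.measure = _
        rw [h1, h2]

/-- This reconciles abstract combinations of Dirac measures with actual sums of measures; additivity
reduces it to one atom. -/
theorem coneMeasure_combination (hp : 1 ≤ p) (w : X →₀ ℝ≥0) :
    coneMeasure hp (PosCone.combination (isBarycentricAlgebra hp) (dirac hp) w) =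
      finsuppMeasure X w := by
  have : (coneMeasure hp).comp (PosCone.combination (isBarycentricAlgebra hp) (dirac hp)) =
      finsuppMeasure X := by
    refine Finsupp.addHom_ext fun x c => ?_
    rw [AddMonoidHom.comp_apply, PosCone.combination_single, finsuppMeasure_single]
    rcases eq_zero_or_pos c with rfl | hc
    · simp
    · have hc' : 0 < (c : ℝ) := hc
      rw [PosCone.ray_of_pos _ _ hc']
      change ENNReal.ofReal (c : ℝ) • Measure.dirac x = _
      rw [ENNReal.ofReal_coe_nnreal]
  exact DFunLike.congr_fun this w

/-- The finitely supported probability measure with given weights. -/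
noncomputable def ofFinsupp (hp : 1 ≤ p) (w : {w : X →₀ ℝ≥0 // (w.sum fun _ c => c) = 1}) :
    WassersteinSpace p X :=
  (PosCone.exists_combination_eq (isBarycentricAlgebra hp) (dirac hp) w.1 w.2).choose

theorem combination_dirac (hp : 1 ≤ p) (w : {w : X →₀ ℝ≥0 // (w.sum fun _ c => c) = 1}) :
    PosCone.combination (isBarycentricAlgebra hp) (dirac hp) w.1 =
      ((⟨1, one_pos, ofFinsupp hp w⟩ : PosCone (isBarycentricAlgebra hp)) :) :=
  (PosCone.exists_combination_eq (isBarycentricAlgebra hp) (dirac hp) w.1 w.2).choose_spec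

theorem ofFinsupp_measure (hp : 1 ≤ p) (w : {w : X →₀ ℝ≥0 // (w.sum fun _ c => c) = 1}) :
    (ofFinsupp hp w).measure = finsuppMeasure X w.1 := by
  rw [← coneMeasure_combination hp, combination_dirac hp w]
  change _ = ENNReal.ofReal 1 • (ofFinsupp hp w).measure
  simp

/-- `μ` is the law of the inclusion of `Y`, and simple functions approximating the inclusion in
`L^p` have finitely supported laws. -/
theorem exists_ofFinsupp_wassersteinDist_lt (hp : 1 ≤ p) (μ : WassersteinSpace p X) {ε : ℝ≥0∞}
    (hε : 0 < ε) : ∃ w : {w : X →₀ ℝ≥0 // (w.sum fun _ c => c) = 1},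
      wassersteinDist p μ.measure (ofFinsupp hp w).measure < ε := by
  have hp0 : 0 < p := by linarith
  obtain ⟨Y, hY, hsc, hμ⟩ := exists_common_support fun _ => μ
  have hprob := isProbabilityMeasure_comap_val hY.measurableSet (hμ 0)
  set m := μ.measure.comap (Subtype.val : Y → X)
  have hm : m.map Subtype.val = μ.measure := map_val_comap_val hY.measurableSet (hμ 0)
  obtain ⟨y₀⟩ := nonempty_of_isProbabilityMeasure m
  -- Starting the approximation at `y₀` bounds its error at `y` by the distance from `y₀` to `y`,
  -- whose `p`-th power is integrable and dominates.
  let T : ℕ → SimpleFunc Y X := SimpleFunc.approxOn (Subtype.val : Y → X) measurable_subtype_coe Y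
    (y₀ : X) y₀.2
  have hfin : ∫⁻ y : Y, edist (y₀ : X) y ^ p ∂m ≠ ∞ := by
    have := μ.hasFiniteMoment.basepoint hp (y₀ : X)
    rw [← hm, lintegral_map ((continuous_const.edist continuous_id').measurable.pow_const p)
      measurable_subtype_coe] at this
    exact this.ne
  have hmeas : ∀ n, Measurable fun y : Y => edist (y : X) (T n y) ^ p := fun n =>
    ((stronglyMeasurable_val.edist (T n).stronglyMeasurable).measurable).pow_const p
  have hlim : Filter.Tendsto (fun n => (∫⁻ y : Y, edist (y : X) (T n y) ^ p ∂m) ^ (1 / p))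
      Filter.atTop (nhds 0) := by
    have h0 : Filter.Tendsto (fun n => ∫⁻ y : Y, edist (y : X) (T n y) ^ p ∂m)
        Filter.atTop (nhds (∫⁻ _ : Y, 0 ∂m)) := by
      refine tendsto_lintegral_of_dominated_convergence (fun y : Y => edist (y₀ : X) y ^ p) hmeas
        (fun n => ae_of_all _ fun y => ?_) hfin (ae_of_all _ fun y => ?_)
      · refine ENNReal.rpow_le_rpow ?_ hp0.le
        rw [edist_comm]
        exact SimpleFunc.edist_approxOn_le measurable_subtype_coe y₀.2 y n
      · have h1 : Filter.Tendsto (fun n => T n y) Filter.atTop (nhds (y : X)) :=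
          SimpleFunc.tendsto_approxOn measurable_subtype_coe y₀.2 (subset_closure y.2)
        have h2 := (tendsto_iff_edist_tendsto_0.1 h1)
        have h3 := (ENNReal.continuous_rpow_const (y := p)).tendsto 0 |>.comp h2
        rw [ENNReal.zero_rpow_of_pos hp0] at h3
        refine h3.congr fun n => ?_
        simp only [Function.comp_apply, edist_comm]
    rw [lintegral_zero] at h0
    have h3 := (ENNReal.continuous_rpow_const (y := 1 / p)).tendsto 0 |>.comp h0
    rwa [ENNReal.zero_rpow_of_pos (by positivity)] at h3
  obtain ⟨n, hn⟩ := (hlim.eventually_lt_const hε).exists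
  have hTprob : IsProbabilityMeasure (m.map (T n)) :=
    Measure.isProbabilityMeasure_map (T n).measurable.aemeasurable
  obtain ⟨w, hw⟩ := exists_finsuppMeasure_eq (m.map (T n)) (T n).range (by
    rw [Measure.map_apply (T n).measurable (Finset.measurableSet _).compl]
    convert measure_empty (μ := m)
    ext y
    simp)
  have hw1 : (w.sum fun _ c => c) = 1 := by
    have := finsuppMeasure_univ w
    rw [← hw, measure_univ] at this
    exact_mod_cast this.symm
  refine ⟨⟨w, hw1⟩, ?_⟩
  rw [ofFinsupp_measure, ← hw, ← hm]
  exact (wassersteinDist_map_le m hp0.le stronglyMeasurable_val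
    (T n).stronglyMeasurable).trans_lt hn

variable [CompleteSpace X]

theorem denseRange_ofFinsupp (hp : 1 ≤ p) :
    @DenseRange _ (emetricSpace hp).toUniformSpace.toTopologicalSpace _ (ofFinsupp (X := X) hp) := by
  let _ : EMetricSpace (WassersteinSpace p X) := emetricSpace hp
  intro μ
  refine EMetric.mem_closure_iff.2 fun ε hε => ?_
  obtain ⟨w, hw⟩ := exists_ofFinsupp_wassersteinDist_lt hp μ hε
  exact ⟨_, ⟨w, rfl⟩, hw⟩

end Dense

/-! ### The universal property -/

section Universal

/-- The value at a finitely supported measure of the affine extension of a map. -/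
noncomputable def finsuppExtend {X B : Type*} {op : I → B → B → B} (hB : IsBarycentricAlgebra op)
    (f : X → B) (w : {w : X →₀ ℝ≥0 // (w.sum fun _ c => c) = 1}) : B :=
  (PosCone.exists_combination_eq hB f w.1 w.2).choose

theorem combination_eq_finsuppExtend {X B : Type*} {op : I → B → B → B}
    (hB : IsBarycentricAlgebra op) (f : X → B)
    (w : {w : X →₀ ℝ≥0 // (w.sum fun _ c => c) = 1}) :
    PosCone.combination hB f w.1 = ((⟨1, one_pos, finsuppExtend hB f w⟩ : PosCone hB) :) :=
  (PosCone.exists_combination_eq hB f w.1 w.2).choose_spec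

/-- The weights of a convex combination. -/
theorem sum_convexComb_weights {X : Type*} (r : I)
    (w w' : {w : X →₀ ℝ≥0 // (w.sum fun _ c => c) = 1}) :
    ((Real.toNNReal r • w.1 + Real.toNNReal (1 - r) • w'.1).sum fun _ c => c) = 1 := by
  rw [Finsupp.sum_add_index' (by simp) (by simp), Finsupp.sum_smul_index (by simp),
    Finsupp.sum_smul_index (by simp), ← Finsupp.mul_sum, ← Finsupp.mul_sum, w.2, w'.2, mul_one,
    mul_one, ← Real.toNNReal_add r.2.1 (by linarith [r.2.2])]
  simp

variable {X : Type u} [MetricSpace X] [MeasurableSpace X] [BorelSpace X] {p : ℝ}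
  {B : Type v} {op : I → B → B → B}

/-- This gives uniqueness on the dense subset: an affine map induces an additive map of cones, so it
commutes with finite combinations. -/
theorem map_ofFinsupp (hp : 1 ≤ p) (hB : IsBarycentricAlgebra op) (h : WassersteinSpace p X → B)
    (hh : ∀ r μ ν, h (convexComb hp r μ ν) = op r (h μ) (h ν))
    (w : {w : X →₀ ℝ≥0 // (w.sum fun _ c => c) = 1}) :
    h (ofFinsupp hp w) = finsuppExtend hB (h ∘ dirac hp) w := by
  have := PosCone.map_combination (h := isBarycentricAlgebra hp) hB h hh (dirac hp) w.1
  rw [combination_dirac, PosCone.map_coe, combination_eq_finsuppExtend] at this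
  exact PosCone.coe_mk_injective this

theorem edist_finsuppExtend_le (hp : 1 ≤ p) [EMetricSpace B] (hB : IsWassersteinAlgebra p op) {f : X → B}
    (hf : LipschitzWith 1 f) (w w' : {w : X →₀ ℝ≥0 // (w.sum fun _ c => c) = 1}) :
    edist (finsuppExtend hB.toIsBarycentricAlgebra f w)
        (finsuppExtend hB.toIsBarycentricAlgebra f w') ≤
      wassersteinDist p (ofFinsupp hp w).measure (ofFinsupp hp w').measure := by
  have hp0 : 0 < p := by linarith
  rw [wassersteinDist, one_div, ENNReal.le_rpow_inv_iff hp0]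
  refine le_iInf₂ fun γ hγ => ?_
  let _ : MeasurableSpace (X × X) := borel (X × X)
  have _ : BorelSpace (X × X) := ⟨rfl⟩
  have hfst : Measurable (Prod.fst : X × X → X) := continuous_fst.measurable
  have hsnd : Measurable (Prod.snd : X × X → X) := continuous_snd.measurable
  have hprob : IsProbabilityMeasure γ := hγ.isProbabilityMeasure
  have hγ1 : γ.map Prod.fst = finsuppMeasure X w.1 := hγ.map_fst.trans (ofFinsupp_measure hp w)
  have hγ2 : γ.map Prod.snd = finsuppMeasure X w'.1 := hγ.map_snd.trans (ofFinsupp_measure hp w')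
  -- Finitely supported marginals force every coupling to be a finite transport plan, to which
  -- `PosCone.costLE_combination` applies.
  obtain ⟨g, rfl⟩ := exists_finsuppMeasure_eq γ (w.1.support ×ˢ w'.1.support) (by
    have hsub : ((w.1.support ×ˢ w'.1.support : Finset (X × X)) : Set (X × X))ᶜ ⊆
        Prod.fst ⁻¹' (w.1.support : Set X)ᶜ ∪ Prod.snd ⁻¹' (w'.1.support : Set X)ᶜ := by
      intro z hz
      simp only [mem_compl_iff, Finset.mem_coe, Finset.mem_product, not_and_or] at hz
      exact hz
    refine measure_mono_null hsub (measure_union_null ?_ ?_)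
    · rw [← Measure.map_apply hfst (Finset.measurableSet _).compl, hγ1,
        finsuppMeasure_compl_support]
    · rw [← Measure.map_apply hsnd (Finset.measurableSet _).compl, hγ2,
        finsuppMeasure_compl_support])
  have hg1 : g.mapDomain Prod.fst = w.1 :=
    finsuppMeasure_injective ((finsuppMeasure_map hfst g).symm.trans hγ1)
  have hg2 : g.mapDomain Prod.snd = w'.1 :=
    finsuppMeasure_injective ((finsuppMeasure_map hsnd g).symm.trans hγ2)
  have hcost := PosCone.costLE_combination hp0.le hB hf g
  rw [hg1, hg2, combination_eq_finsuppExtend, combination_eq_finsuppExtend] at hcost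
  rw [lintegral_finsuppMeasure]
  rcases hcost with ⟨h0, -⟩ | ⟨s, hs, x, y, hx, hy, hle⟩
  · exact absurd h0 WithZero.coe_ne_zero
  · obtain rfl : x = _ := (PosCone.coe_mk_injective hx).symm
    obtain rfl : y = _ := (PosCone.coe_mk_injective hy).symm
    obtain rfl : s = 1 := (congrArg PosCone.weight (WithZero.coe_inj.1 hx)).symm
    simpa using hle

/-- One and the same weight function serves in `P_p(X)` and in `B`, so the extension is affine on
finitely supported measures. -/
theorem exists_convexComb_weights (hp : 1 ≤ p) (hB : IsBarycentricAlgebra op) (f : X → B) (r : I)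
    (w w' : {w : X →₀ ℝ≥0 // (w.sum fun _ c => c) = 1}) :
    ∃ w'' : {w : X →₀ ℝ≥0 // (w.sum fun _ c => c) = 1},
      ofFinsupp hp w'' = convexComb hp r (ofFinsupp hp w) (ofFinsupp hp w') ∧
      finsuppExtend hB f w'' = op r (finsuppExtend hB f w) (finsuppExtend hB f w') := by
  have hr : Real.toNNReal r + Real.toNNReal (1 - r) = 1 := by
    rw [← Real.toNNReal_add r.2.1 (by linarith [r.2.2])]
    simp
  have hr' : (r : ℝ) = Real.toNNReal r := (Real.coe_toNNReal _ r.2.1).symm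
  refine ⟨⟨_, sum_convexComb_weights r w w'⟩, ?_, ?_⟩
  · have := PosCone.combination_op _ _ _ _ (combination_dirac hp w) (combination_dirac hp w')
      _ _ hr r hr'
    exact PosCone.coe_mk_injective
      ((combination_dirac hp ⟨_, sum_convexComb_weights r w w'⟩).symm.trans this)
  · have := PosCone.combination_op _ _ _ _ (combination_eq_finsuppExtend hB f w)
      (combination_eq_finsuppExtend hB f w') _ _ hr r hr'
    exact PosCone.coe_mk_injective
      ((combination_eq_finsuppExtend hB f ⟨_, sum_convexComb_weights r w w'⟩).symm.trans this)

variable [CompleteSpace X]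

theorem existsUnique_extension (hp : 1 ≤ p) [EMetricSpace B] [CompleteSpace B]
    (hB : IsWassersteinAlgebra p op) {f : X → B} (hf : LipschitzWith 1 f) :
    ∃! h : WassersteinSpace p X → B,
      @IsWassersteinHom _ _ (emetricSpace hp) _ (convexComb hp) op h ∧
        ∀ x, h (dirac hp x) = f x := by
  let _ : EMetricSpace (WassersteinSpace p X) := emetricSpace hp
  let W := {w : X →₀ ℝ≥0 // (w.sum fun _ c => c) = 1}
  let j : W → WassersteinSpace p X := ofFinsupp hp
  let h₀ : W → B := finsuppExtend hB.toIsBarycentricAlgebra f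
  -- With the distance pulled back along `j`, the bound on finitely supported measures says that
  -- `h₀` is nonexpansive, hence extends uniformly.
  let _ : PseudoEMetricSpace W := PseudoEMetricSpace.induced j inferInstance
  have hj : IsUniformInducing j := ⟨rfl⟩
  have hdense : DenseRange j := denseRange_ofFinsupp hp
  have hlip : LipschitzWith 1 h₀ := fun w w' => by
    rw [ENNReal.coe_one, one_mul]
    exact edist_finsuppExtend_le hp hB hf w w'
  let h : WassersteinSpace p X → B := (hj.isDenseInducing hdense).extend h₀
  have hcont : Continuous h :=
    (uniformContinuous_uniformly_extend hj hdense hlip.uniformContinuous).continuous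
  have hext : ∀ w, h (j w) = h₀ w := uniformly_extend_of_ind hj hdense hlip.uniformContinuous
  have hhlip : LipschitzWith 1 h := fun μ ν => by
    rw [ENNReal.coe_one, one_mul]
    refine hdense.induction_on₂ (p := fun μ ν => edist (h μ) (h ν) ≤ edist μ ν)
      (isClosed_le (by fun_prop) (by fun_prop)) (fun w w' => ?_) μ ν
    rw [hext, hext]
    exact edist_finsuppExtend_le hp hB hf w w'
  have hopA : ∀ r, Continuous fun z : WassersteinSpace p X × WassersteinSpace p X =>
    convexComb hp r z.1 z.2 := fun r => ((isWassersteinAlgebra hp).nonexpansive r).continuous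
  have hopB : ∀ r, Continuous fun z : B × B => op r z.1 z.2 :=
    fun r => (hB.nonexpansive r).continuous
  have haff : ∀ r μ ν, h (convexComb hp r μ ν) = op r (h μ) (h ν) := fun r μ ν => by
    refine hdense.induction_on₂ (p := fun μ ν => h (convexComb hp r μ ν) = op r (h μ) (h ν))
      (isClosed_eq (hcont.comp (hopA r))
        ((hopB r).comp ((hcont.comp continuous_fst).prodMk (hcont.comp continuous_snd))))
      (fun w w' => ?_) μ ν
    obtain ⟨w'', h1, h2⟩ := exists_convexComb_weights hp hB.toIsBarycentricAlgebra f r w w'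
    have h3 := hext w''
    rw [hext, hext]
    exact (congrArg h h1.symm).trans (h3.trans h2)
  have hdirac : ∀ x, h (dirac hp x) = f x := fun x => by
    let w : W := ⟨Finsupp.single x 1, by simp⟩
    have h1 : j w = dirac hp x := by
      refine WassersteinSpace.ext ((ofFinsupp_measure hp w).trans ?_)
      rw [finsuppMeasure_single, ENNReal.coe_one, one_smul]
      rfl
    have h2 := combination_eq_finsuppExtend hB.toIsBarycentricAlgebra f w
    rw [PosCone.combination_single, PosCone.ray_of_pos _ _ (by simp)] at h2
    rw [← h1, hext]
    exact (PosCone.coe_mk_injective h2).symm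
  refine ⟨h, ⟨⟨hhlip, haff⟩, hdirac⟩, fun k hk => ?_⟩
  refine hdense.equalizer hk.1.nonexpansive.continuous hcont (funext fun w => ?_)
  have : k ∘ dirac hp = f := funext hk.2
  rw [Function.comp_apply, Function.comp_apply, hext]
  exact (map_ofFinsupp hp hB.toIsBarycentricAlgebra k hk.1.map_op w).trans (by rw [this])

end Universal

end WassersteinSpace

theorem mainTheorem8 (p : ℝ) (hp : 1 ≤ p) (X : Type u) [MetricSpace X] [CompleteSpace X]
    [MeasurableSpace X] [BorelSpace X] :
    ∃ _ : EMetricSpace (WassersteinSpace p X),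
      (∀ μ ν : WassersteinSpace p X, edist μ ν = wassersteinDist p μ.measure ν.measure) ∧
      IsFreeCompleteWassersteinAlgebra.{u, u, v} p
        (WassersteinSpace.convexComb (X := X) hp) (WassersteinSpace.dirac hp) := by
  refine ⟨WassersteinSpace.emetricSpace hp, fun _ _ => rfl, ?_⟩
  exact @IsFreeCompleteWassersteinAlgebra.mk p X _ _ (WassersteinSpace.emetricSpace hp) _ _
    (WassersteinSpace.completeSpace hp) (WassersteinSpace.isWassersteinAlgebra hp)
    (WassersteinSpace.lipschitzWith_dirac hp)
    fun _ _ _ _ hB _ hf => WassersteinSpace.existsUnique_extension hp hB hf
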